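/- **Setting.** Let $d\ge 1$, let $|\cdot|$ be the Euclidean norm and $B(x,r)=\{y\in\mathbb Z^d: |x-y|<r\}$. Conductances on $\mathbb Z^d$ are numbers $C_{xy}=C_{yx}\in[0,\infty)$ for $x\ne y$ (put $C_{xx}=0$), and $\nu_x=\sum_y C_{xy}$. Consider the assumptions: (A1) $c_1\le \nu_x\le c_2$ for all $x\in\mathbb Z^d$, where $c_1,c_2>0$. (A2) $M_0\ge 1$, $\delta>0$, and for all $x,y\in\mathbb Z^d$ with $|x-y|=1$ there are $N\ge 2$ and $x_1,\dots,x_N\in B(x,M_0)$ with $x_1=x$, $x_N=y$ and $C_{x_ix_{i+1}}\ge\delta$ for $1\le i\le N-1$. (A3) $\varphi:\{1,2,\dots\}\to[0,\infty)$ is nonincreasing, $\sum_{i\ge1} i^{d+1}\varphi(i)<\infty$, there is $c>0$ with $\varphi(2i)\le c\,\varphi(i)$ for all $i\ge 1$, and $C_{xy}\le\varphi(\lfloor|x-y|\rfloor)$ for all $x\ne y$. Let $(X_n)_{n\ge0}$ be the discrete-time Markov chain on $\mathbb Z^d$ with transition probabilities $\mathbb P^x(X_1=y)=C_{xy}/\nu_x$.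 Let $(Y_t)_{t\ge0}$ be the continuous-time chain given by $Y_t=X_n$ for $T_n\le t<T_{n+1}$, where $T_0=0$, $T_n=\sum_{k=1}^n U_k^{X_{k-1}}$, and the $U_k^x$ are independent exponential random variables, $U_k^x$ with parameter $\nu_x$, independent of $X$. Under $\mathbb P^x$ both start at $x$. For a process $Z$ and $S\subset\mathbb Z^d$ let $\tau_S(Z)=\inf\{t\ge0: Z_t\notin S\}$ (with $\inf\emptyset=\infty$). **Proposition 3.3.** For all $d,c_1,c_2,M_0,\delta,\varphi$, all $A>0$ and all $0<B<1$ there exist $\gamma_1,\gamma_2\in(0,1)$, depending only on these data, such that for all conductances satisfying (A1)–(A3) with these constants and this $\varphi$, for every real $D>0$ and every $x\in\mathbb Z^d$, $$\mathbb P^x\bigl(\tau_{B(x,AD)}(Y)<\gamma_1D^2\bigr)\le B\qquad\text{and}\qquad \mathbb P^x\bigl(\tau_{B(x,AD)}(X)<\gamma_2D^2\bigr)\le B .$$ -/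

import Mathlib

open MeasureTheory ProbabilityTheory
open scoped NNReal ENNReal

noncomputable section

/-- The lattice `ℤ^d`. -/
abbrev IntLattice (d : ℕ) : Type := Fin d → ℤ

/-- The Euclidean norm `|x|` of a lattice point. -/
def latticeNorm {d : ℕ} (x : IntLattice d) : ℝ :=
  ‖(WithLp.toLp 2 (fun i => (x i : ℝ)) : EuclideanSpace ℝ (Fin d))‖

/-- The open Euclidean ball `B(x, r) = {y ∈ ℤ^d : |x - y| < r}`. -/
def latticeBall {d : ℕ} (x : IntLattice d) (r : ℝ) : Set (IntLattice d) :=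
  {y | latticeNorm (x - y) < r}

/-- Symmetric conductances `C x y ∈ [0, ∞)` on `ℤ^d`. A conductance is attached only to pairs of
distinct points, so the diagonal is set to `0`. The total conductance at each point is positive and
finite, which is what is needed for the associated Markov chains to make sense. -/
structure Conductances (d : ℕ) where
  C : IntLattice d → IntLattice d → ℝ≥0
  symm : ∀ x y, C x y = C y x
  diag : ∀ x, C x x = 0
  summable : ∀ x, Summable (C x)
  pos : ∀ x, 0 < ∑' y, C x y

namespace Conductances

variable {d : ℕ} (K : Conductances d)

/-- `ν_x = ∑_y C_{xy}`. -/
def nu (x : IntLattice d) : ℝ≥0 := ∑' y, K.C x y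

/-- Assumption (A1): the total conductances are bounded below and above. -/
def A1 (c₁ c₂ : ℝ) : Prop :=
  0 < c₁ ∧ 0 < c₂ ∧ ∀ x, c₁ ≤ (K.nu x : ℝ) ∧ (K.nu x : ℝ) ≤ c₂

/-- Assumption (A2): nearest neighbours `x, y` are joined by a path `z 1 = x, …, z N = y` inside
`B(x, M₀)` whose steps all have conductance at least `δ`. -/
def A2 (M₀ δ : ℝ) : Prop :=
  1 ≤ M₀ ∧ 0 < δ ∧ ∀ x y : IntLattice d, latticeNorm (x - y) = 1 →
    ∃ (N : ℕ) (z : ℕ → IntLattice d), 2 ≤ N ∧ z 1 = x ∧ z N = y ∧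
      (∀ i, 1 ≤ i → i ≤ N → z i ∈ latticeBall x M₀) ∧
      ∀ i, 1 ≤ i → i + 1 ≤ N → δ ≤ (K.C (z i) (z (i + 1)) : ℝ)

/-- Assumption (A3), for a function `φ` on `{1, 2, …}` (the value `φ 0` plays no role).
At non-integer distances `φ` is read as the step function `r ↦ φ ⌊r⌋`. -/
def A3 (φ : ℕ → ℝ) : Prop :=
  (∀ i, 1 ≤ i → 0 ≤ φ i) ∧
  (∀ i j, 1 ≤ i → i ≤ j → φ j ≤ φ i) ∧
  Summable (fun i : ℕ => (i : ℝ) ^ (d + 1) * φ i) ∧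
  (∃ c : ℝ, 0 < c ∧ ∀ i, 1 ≤ i → φ (2 * i) ≤ c * φ i) ∧
  ∀ x y : IntLattice d, x ≠ y → (K.C x y : ℝ) ≤ φ ⌊latticeNorm (x - y)⌋₊

lemma tsum_coe_eq (x : IntLattice d) : ∑' y, (K.C x y : ℝ≥0∞) = K.nu x :=
  (ENNReal.coe_tsum (K.summable x)).symm

/-- The one-step law `y ↦ C_{xy} / ν_x` of the chain started at `x`. -/
def step (x : IntLattice d) : PMF (IntLattice d) :=
  PMF.normalize (fun y => (K.C x y : ℝ≥0∞))
    (by rw [K.tsum_coe_eq]; exact ENNReal.coe_ne_zero.2 (K.pos x).ne')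
    (by rw [K.tsum_coe_eq]; exact ENNReal.coe_ne_top)

/-- The transition kernel of the discrete-time chain. -/
def stepKernel : Kernel (IntLattice d) (IntLattice d) :=
  Kernel.ofFunOfCountable fun x => (K.step x).toMeasure

instance : IsMarkovKernel K.stepKernel :=
  ⟨fun x => by
    change IsProbabilityMeasure (K.step x).toMeasure
    infer_instance⟩

/-- The law of `X_{n+1}` given the history `X_0, …, X_n`: it depends on `X_n` only. -/
def histKernel (n : ℕ) : Kernel (∀ _ : Finset.Iic n, IntLattice d) (IntLattice d) :=
  K.stepKernel.comap (fun h => h ⟨n, Finset.mem_Iic.2 le_rfl⟩) (measurable_pi_apply _)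

instance (n : ℕ) : IsMarkovKernel (K.histKernel n) := by
  unfold histKernel; infer_instance

/-- The law `ℙ^x` of the trajectory `(X_n)_{n ≥ 0}` of the discrete-time Markov chain with
transition probabilities `C_{xy} / ν_x` and `X_0 = x`. -/
def chainLaw (x : IntLattice d) : Measure (ℕ → IntLattice d) :=
  Kernel.traj (X := fun _ => IntLattice d) K.histKernel 0 (fun _ => x)

instance (x : IntLattice d) : IsProbabilityMeasure (K.chainLaw x) := by
  unfold chainLaw; infer_instance

/-- The law of an independent family of exponential random variables `U_i^x`, `i ∈ ℕ`, `x ∈ ℤ^d`,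
where `U_i^x` has parameter `ν_x`. -/
def clockLaw : Measure (ℕ × IntLattice d → ℝ) :=
  Measure.infinitePi fun p => expMeasure (K.nu p.2)

instance : IsProbabilityMeasure K.clockLaw := by
  have (p : ℕ × IntLattice d) : IsProbabilityMeasure (expMeasure (K.nu p.2)) :=
    isProbabilityMeasure_expMeasure (NNReal.coe_pos.2 (K.pos p.2))
  unfold clockLaw; infer_instance

/-- The law `ℙ^x` of the chain `X` started at `x` together with independent exponential clocks. -/
def pathLaw (x : IntLattice d) : Measure ((ℕ → IntLattice d) × (ℕ × IntLattice d → ℝ)) :=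
  (K.chainLaw x).prod K.clockLaw

instance (x : IntLattice d) : IsProbabilityMeasure (K.pathLaw x) := by
  unfold pathLaw; infer_instance

end Conductances

/-- The jump times `T_0 = 0`, `T_n = ∑_{k=1}^n U_k^{X_{k-1}}` for a trajectory `X` and clocks `U`. -/
def jumpTime {d : ℕ} (ω : (ℕ → IntLattice d) × (ℕ × IntLattice d → ℝ)) (n : ℕ) : ℝ :=
  ∑ k ∈ Finset.range n, ω.2 (k + 1, ω.1 k)

open Classical in
/-- The continuous-time chain: `Y_t = X_n` if `T_n ≤ t < T_{n+1}`.
(If there is no such `n`, which has probability zero when `ν` is bounded, `Y_t := X_0`.) -/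
def contChain {d : ℕ} (ω : (ℕ → IntLattice d) × (ℕ × IntLattice d → ℝ)) (t : ℝ≥0) : IntLattice d :=
  if h : ∃ n, jumpTime ω n ≤ t ∧ (t : ℝ) < jumpTime ω (n + 1) then ω.1 (Nat.find h) else ω.1 0

/-- Exit time `inf {t ≥ 0 : Z_t ∉ S}` of a continuous-time path, `∞` if the path stays in `S`. -/
def exitTime {d : ℕ} (S : Set (IntLattice d)) (Z : ℝ≥0 → IntLattice d) : ℝ≥0∞ :=
  ⨅ (t : ℝ≥0) (_ : Z t ∉ S), (t : ℝ≥0∞)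

/-- Exit time `inf {n ≥ 0 : X_n ∉ S}` of a discrete-time path, `∞` if the path stays in `S`. -/
def discreteExitTime {d : ℕ} (S : Set (IntLattice d)) (X : ℕ → IntLattice d) : ℝ≥0∞ :=
  ⨅ (n : ℕ) (_ : X n ∉ S), (n : ℝ≥0∞)

end

/-!
The exit bound rests on a diffusive estimate for the first moment,
`∑_y ℙ^x(Z_m = y) |x - y|₁ ≤ S √m`, uniform in the starting point `x`, for the lazy version `Z` of the
chain. The chain has a drift in general, so no martingale argument is available; the estimate is
Nash's, for the density `p_m` of `Z_m` with respect to the reversible measure `ν`: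

* The decrease of `∑ ν p_m²` in one step dominates the Dirichlet form. By (A2) the latter dominates the
  nearest-neighbour form, so that Nash's inequality on `ℤ^d` gives `∑ ν p_m² ≤ R m^{-d/2}`
  (`Conductances.exists_sq_dens_bound`). By Jensen, the entropy `Q_m = -∑ ν p_m log p_m` is at least
  `(d/2) log m - log R`.
* The increment of the first moment `M_m` is antisymmetrized and estimated by Cauchy-Schwarz: the
  second moment of the jumps is bounded by (A3), and the other factor is the entropy production. Hence
  `M_{m+1} - M_m ≤ ε b + 3/(2ε) (Q_{m+1} - Q_m)` for all `ε > 0` (`LazyWeights.moment_le_entropy`).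
* The entropy is at most `d log (M_m + 1)` up to a constant (`LazyWeights.entropy_le`). On the time
  interval from `m/4` to `m`, with `ε` of order `m^{-1/2}`, these bounds give a recursion for
  `M_m / √m` that keeps it bounded (`exists_moment_bound`).

The moment bound becomes an exit bound by stopping the lazy chain at an independent geometric time
with mean of order `n`. Let `h(w)` be the probability that the chain started at `w` is then at distance
at least `r/2` from `x`. By the memoryless property `h` is superharmonic for the chain killed at a rate
of order `1/n`; it is small at `x`, and at least `1/2` outside `B(x, r)`. The maximal inequality
bounds the probability of an exit before time `n` by `16 S √n / r` (`Conductances.exit_le`).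

The continuous-time chain can only leave the ball early if the discrete chain does so or if the first
`n` clocks, whose rates are at most `c₂`, ring too fast; the latter is excluded by Chernoff's bound
(`Conductances.pathLaw_jumpTime_lt`).
-/

/-! ### Lazy reversible chains and dissipation of convex functionals -/

/-- Symmetric nonnegative weights on a set `V` with finite positive row sums `ν`, which put at least
half of each row sum on the diagonal: the edge measure of a lazy reversible chain with reversible
measure `ν`. -/
structure LazyWeights (V : Type*) where
  w : V → V → ℝ
  ν : V → ℝ
  nonneg : ∀ y z, 0 ≤ w y z
  symm : ∀ y z, w y z = w z y
  hasSum : ∀ y, HasSum (w y) (ν y)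
  pos : ∀ y, 0 < ν y
  lazy : ∀ y, ν y ≤ 2 * w y y

namespace LazyWeights

variable {V : Type*} (W : LazyWeights V)

/-- One step of the chain acting on functions: the `w`-weighted average of `f` around `y`. By
reversibility it also maps the density (with respect to `ν`) of the chain at time `m` to the density
at time `m + 1`. -/
noncomputable def avg (f : V → ℝ) (y : V) : ℝ := (∑' z, W.w y z * f z) / W.ν y

lemma le_ν (y z : V) : W.w y z ≤ W.ν z := by
  rw [W.symm]
  exact le_hasSum (W.hasSum z) y fun j _ => W.nonneg z j

lemma ν_mul_avg (f : V → ℝ) (y : V) : W.ν y * W.avg f y = ∑' z, W.w y z * f z := by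
  rw [avg, mul_div_cancel₀ _ (W.pos y).ne']

lemma avg_nonneg {f : V → ℝ} (hf : ∀ z, 0 ≤ f z) (y : V) : 0 ≤ W.avg f y :=
  div_nonneg (tsum_nonneg fun z => mul_nonneg (W.nonneg y z) (hf z)) (W.pos y).le

lemma summable_row {F : V → ℝ} (hF : Summable fun y => W.ν y * F y) (y : V) :
    Summable fun z => W.w y z * F z := by
  refine Summable.of_norm_bounded hF.norm fun z => ?_
  rw [norm_mul, norm_mul]
  refine mul_le_mul_of_nonneg_right ?_ (norm_nonneg _)
  rw [Real.norm_of_nonneg (W.nonneg y z), Real.norm_of_nonneg (W.pos z).le]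
  exact W.le_ν y z

lemma summable_fst {F : V → ℝ} (hF : Summable fun y => W.ν y * F y) :
    Summable fun p : V × V => W.w p.1 p.2 * F p.1 := by
  rw [← summable_norm_iff]
  rw [summable_prod_of_nonneg (fun _ => norm_nonneg _)]
  have h : ∀ y z, ‖W.w y z * F y‖ = W.w y z * |F y| := fun y z => by
    rw [norm_mul, Real.norm_of_nonneg (W.nonneg y z), Real.norm_eq_abs]
  simp only [h]
  refine ⟨fun y => (W.hasSum y).summable.mul_right _, ?_⟩
  simp only [tsum_mul_right, (W.hasSum _).tsum_eq]
  refine hF.norm.congr fun y => ?_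
  rw [norm_mul, Real.norm_of_nonneg (W.pos y).le, Real.norm_eq_abs]

lemma hasSum_fst {F : V → ℝ} (hF : Summable fun y => W.ν y * F y) :
    HasSum (fun p : V × V => W.w p.1 p.2 * F p.1) (∑' y, W.ν y * F y) := by
  have h := (W.summable_fst hF).hasSum
  rw [(W.summable_fst hF).tsum_prod] at h
  simpa only [tsum_mul_right, (W.hasSum _).tsum_eq] using h

lemma hasSum_snd {F : V → ℝ} (hF : Summable fun y => W.ν y * F y) :
    HasSum (fun p : V × V => W.w p.1 p.2 * F p.2) (∑' y, W.ν y * F y) := by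
  refine ((Equiv.prodComm V V).hasSum_iff.1 ?_)
  convert W.hasSum_fst hF using 2 with p
  simp [W.symm p.2 p.1]

/-- The chain preserves mass: `ν` is invariant. -/
lemma hasSum_avg {f : V → ℝ} (hf : Summable fun y => W.ν y * f y) :
    HasSum (fun y => W.ν y * W.avg f y) (∑' y, W.ν y * f y) := by
  have h := W.hasSum_snd hf
  simpa only [ν_mul_avg] using h.prod_fiberwise fun y => (W.summable_row hf y).hasSum

/-- Local form of the dissipation estimate: the loss of a uniformly convex functional `∑ ψ ∘ f` in
one step, localized at `y`, controls the weighted square oscillation of `χ ∘ f` around `y`. -/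
lemma row_gap {ψ ψ' χ : ℝ → ℝ}
    (hψ : ∀ a b, 0 ≤ a → 0 < b → ψ b + ψ' b * (a - b) + (χ a - χ b) ^ 2 ≤ ψ a) {f : V → ℝ}
    (hf : ∀ y, 0 ≤ f y) (hfs : Summable fun y => W.ν y * f y)
    (hψf : Summable fun y => W.ν y * ψ (f y)) (y : V) :
    Summable (fun z => W.w y z * (χ (f z) - χ (f y)) ^ 2) ∧
      ∑' z, W.w y z * (χ (f z) - χ (f y)) ^ 2 ≤
        6 * (∑' z, W.w y z * ψ (f z) - W.ν y * ψ (W.avg f y)) := by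
  have hr := W.summable_row hfs y
  have hrψ := W.summable_row hψf y
  set b := W.avg f y with hb
  -- where the average vanishes, so does `f` at every neighbour, and the tangent line is not needed
  have key : ∃ k, ∀ z, W.w y z * (χ (f z) - χ b) ^ 2 ≤
      W.w y z * ψ (f z) - W.w y z * ψ b - k * (W.w y z * f z - W.w y z * b) := by
    rcases (W.avg_nonneg hf y).eq_or_lt with h0 | h0
    · refine ⟨0, fun z => ?_⟩
      have h1 : ∑' z, W.w y z * f z = 0 := by rw [← ν_mul_avg, ← h0, mul_zero]
      have h2 : W.w y z * f z = 0 :=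
        congrFun ((hasSum_zero_iff_of_nonneg
          fun z => mul_nonneg (W.nonneg y z) (hf z)).1 (h1 ▸ hr.hasSum)) z
      rcases mul_eq_zero.1 h2 with h3 | h3
      · simp [h3]
      · have : f z = b := by rw [h3, hb, h0]
        simp [this]
    · refine ⟨ψ' b, fun z => ?_⟩
      have := mul_le_mul_of_nonneg_left (hψ (f z) b (hf z) h0) (W.nonneg y z)
      linarith
  obtain ⟨k, hk⟩ := key
  have hs : HasSum (fun z => W.w y z * ψ (f z) - W.w y z * ψ b -
      k * (W.w y z * f z - W.w y z * b)) (∑' z, W.w y z * ψ (f z) - W.ν y * ψ b) := by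
    have h1 := (hrψ.hasSum.sub ((W.hasSum y).mul_right (ψ b))).sub
      ((hr.hasSum.sub ((W.hasSum y).mul_right b)).mul_left k)
    rw [← W.ν_mul_avg f y, ← hb, sub_self, mul_zero, sub_zero] at h1
    exact h1
  have hs1 : Summable fun z => W.w y z * (χ (f z) - χ b) ^ 2 :=
    Summable.of_nonneg_of_le (fun z => mul_nonneg (W.nonneg y z) (sq_nonneg _)) hk hs.summable
  have hle : ∑' z, W.w y z * (χ (f z) - χ b) ^ 2 ≤
      ∑' z, W.w y z * ψ (f z) - W.ν y * ψ b := by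
    rw [← hs.tsum_eq]
    exact hs1.tsum_le_tsum hk hs.summable
  have hyy : W.ν y * (χ (f y) - χ b) ^ 2 ≤ 2 * ∑' z, W.w y z * (χ (f z) - χ b) ^ 2 := by
    have h1 := hs1.le_tsum y fun j _ => mul_nonneg (W.nonneg y j) (sq_nonneg _)
    have h2 := mul_le_mul_of_nonneg_right (W.lazy y) (sq_nonneg (χ (f y) - χ b))
    linarith
  have hsb := (hs1.mul_left 2).add ((W.hasSum y).summable.mul_right (2 * (χ (f y) - χ b) ^ 2))
  have hpt : ∀ z, W.w y z * (χ (f z) - χ (f y)) ^ 2 ≤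
      2 * (W.w y z * (χ (f z) - χ b) ^ 2) + W.w y z * (2 * (χ (f y) - χ b) ^ 2) := fun z => by
    have : (χ (f z) - χ (f y)) ^ 2 ≤ 2 * (χ (f z) - χ b) ^ 2 + 2 * (χ (f y) - χ b) ^ 2 := by
      nlinarith [sq_nonneg ((χ (f z) - χ b) + (χ (f y) - χ b))]
    have := mul_le_mul_of_nonneg_left this (W.nonneg y z)
    linarith
  have hs2 : Summable fun z => W.w y z * (χ (f z) - χ (f y)) ^ 2 :=
    Summable.of_nonneg_of_le (fun z => mul_nonneg (W.nonneg y z) (sq_nonneg _)) hpt hsb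
  refine ⟨hs2, (hs2.tsum_le_tsum hpt hsb).trans ?_⟩
  rw [(hs1.mul_left 2).tsum_add ((W.hasSum y).summable.mul_right _), tsum_mul_left,
    tsum_mul_right, (W.hasSum y).tsum_eq]
  linarith

/-- Dissipation estimate: the decrease of a uniformly convex functional along one step of the chain
controls the Dirichlet form of `χ ∘ f`, where `χ` measures the convexity of `ψ`. -/
lemma gap {ψ ψ' χ : ℝ → ℝ}
    (hψ : ∀ a b, 0 ≤ a → 0 < b → ψ b + ψ' b * (a - b) + (χ a - χ b) ^ 2 ≤ ψ a) {f : V → ℝ}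
    (hf : ∀ y, 0 ≤ f y) (hfs : Summable fun y => W.ν y * f y)
    (hψf : Summable fun y => W.ν y * ψ (f y))
    (hψg : Summable fun y => W.ν y * ψ (W.avg f y)) :
    Summable (fun p : V × V => W.w p.1 p.2 * (χ (f p.2) - χ (f p.1)) ^ 2) ∧
      ∑' p : V × V, W.w p.1 p.2 * (χ (f p.2) - χ (f p.1)) ^ 2 ≤
        6 * (∑' y, W.ν y * ψ (f y) - ∑' y, W.ν y * ψ (W.avg f y)) := by
  have hrow := W.row_gap hψ hf hfs hψf
  have hS : HasSum (fun y => 6 * (∑' z, W.w y z * ψ (f z) - W.ν y * ψ (W.avg f y)))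
      (6 * (∑' y, W.ν y * ψ (f y) - ∑' y, W.ν y * ψ (W.avg f y))) :=
    (((W.hasSum_snd hψf).prod_fiberwise fun y => (W.summable_row hψf y).hasSum).sub
      hψg.hasSum).mul_left 6
  have hsum : Summable (fun p : V × V => W.w p.1 p.2 * (χ (f p.2) - χ (f p.1)) ^ 2) := by
    rw [summable_prod_of_nonneg fun p => mul_nonneg (W.nonneg _ _) (sq_nonneg _)]
    exact ⟨fun y => (hrow y).1, Summable.of_nonneg_of_le
      (fun y => tsum_nonneg fun z => mul_nonneg (W.nonneg _ _) (sq_nonneg _))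
      (fun y => (hrow y).2) hS.summable⟩
  refine ⟨hsum, ?_⟩
  rw [hsum.tsum_prod, ← hS.tsum_eq]
  exact hsum.prod.tsum_le_tsum (fun y => (hrow y).2) hS.summable

end LazyWeights

/-! ### Increments of the first moment and of the entropy -/

namespace LazyWeights

variable {V : Type*} (W : LazyWeights V)

lemma summable_snd_mul_fst {d : V → ℝ} {ρ : V → V → ℝ} {M₂ : ℝ} (hd₀ : ∀ y, 0 ≤ d y)
    (hd : ∀ y z, |d y - d z| ≤ ρ y z) (hρ : ∀ y, Summable fun z => W.w y z * ρ y z ^ 2)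
    (hM : ∀ y, ∑' z, W.w y z * ρ y z ^ 2 ≤ M₂ * W.ν y) {f : V → ℝ} (hf : ∀ y, 0 ≤ f y)
    (hfs : Summable fun y => W.ν y * f y) (hfd : Summable fun y => W.ν y * (f y * d y)) :
    Summable fun p : V × V => W.w p.1 p.2 * (d p.2 * f p.1) := by
  rw [summable_prod_of_nonneg fun p => mul_nonneg (W.nonneg _ _) (mul_nonneg (hd₀ _) (hf _))]
  have hpt : ∀ y z, W.w y z * (d z * f y) ≤
      (W.w y z * (d y + 1) + W.w y z * ρ y z ^ 2) * f y := fun y z => by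
    have h1 : d z ≤ d y + 1 + ρ y z ^ 2 := by
      have := (abs_le.1 (hd y z)).1
      nlinarith [sq_nonneg (ρ y z - 1)]
    have := mul_le_mul_of_nonneg_left (mul_le_mul_of_nonneg_right h1 (hf y)) (W.nonneg y z)
    linarith
  have hs : ∀ y, Summable fun z => (W.w y z * (d y + 1) + W.w y z * ρ y z ^ 2) * f y := fun y =>
    (((W.hasSum y).summable.mul_right _).add (hρ y)).mul_right _
  have hrow : ∀ y, Summable fun z => W.w y z * (d z * f y) := fun y =>
    Summable.of_nonneg_of_le (fun z => mul_nonneg (W.nonneg _ _) (mul_nonneg (hd₀ _) (hf _)))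
      (hpt y) (hs y)
  refine ⟨hrow, Summable.of_nonneg_of_le
    (fun y => tsum_nonneg fun z => mul_nonneg (W.nonneg _ _) (mul_nonneg (hd₀ _) (hf _)))
    (fun y => ((hrow y).tsum_le_tsum (hpt y) (hs y))) ?_⟩
  refine Summable.of_nonneg_of_le
    (fun y => tsum_nonneg fun z => mul_nonneg (add_nonneg (mul_nonneg (W.nonneg _ _)
      (add_nonneg (hd₀ _) zero_le_one)) (mul_nonneg (W.nonneg _ _) (sq_nonneg _))) (hf _))
    (fun y => ?_) (hfd.add (hfs.mul_left (1 + M₂)))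
  rw [tsum_mul_right, ((W.hasSum y).summable.mul_right _).tsum_add (hρ y), tsum_mul_right,
    (W.hasSum y).tsum_eq]
  have := mul_le_mul_of_nonneg_right (hM y) (hf y)
  linarith

/-- The increment in one step of the moment `∑ ν f d`, as a sum over directed edges. -/
lemma hasSum_moment_increment {d : V → ℝ} {ρ : V → V → ℝ} {M₂ : ℝ} (hd₀ : ∀ y, 0 ≤ d y)
    (hd : ∀ y z, |d y - d z| ≤ ρ y z) (hρ : ∀ y, Summable fun z => W.w y z * ρ y z ^ 2)
    (hM : ∀ y, ∑' z, W.w y z * ρ y z ^ 2 ≤ M₂ * W.ν y) {f : V → ℝ} (hf : ∀ y, 0 ≤ f y)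
    (hfs : Summable fun y => W.ν y * f y) (hfd : Summable fun y => W.ν y * (f y * d y)) :
    Summable (fun y => W.ν y * (W.avg f y * d y)) ∧
      HasSum (fun p : V × V => W.w p.1 p.2 * ((d p.2 - d p.1) * f p.1))
        (∑' y, W.ν y * (W.avg f y * d y) - ∑' y, W.ν y * (f y * d y)) := by
  have h1 := W.summable_snd_mul_fst hd₀ hd hρ hM hf hfs hfd
  have h2 : HasSum (fun p : V × V => W.w p.1 p.2 * (d p.1 * f p.2))
      (∑' p : V × V, W.w p.1 p.2 * (d p.2 * f p.1)) := by
    refine ((Equiv.prodComm V V).hasSum_iff.1 ?_)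
    convert h1.hasSum using 2 with p
    simp [W.symm p.2 p.1]
  have h3 : HasSum (fun y => W.ν y * (W.avg f y * d y))
      (∑' p : V × V, W.w p.1 p.2 * (d p.2 * f p.1)) := by
    have h4 : ∀ y, HasSum (fun z => W.w y z * (d y * f z)) (W.ν y * (W.avg f y * d y)) :=
      fun y => by
        have h5 := (W.summable_row hfs y).hasSum.mul_left (d y)
        rw [← W.ν_mul_avg f y] at h5
        have h6 : ∀ z, W.w y z * (d y * f z) = d y * (W.w y z * f z) := fun z => by ring
        have h7 : W.ν y * (W.avg f y * d y) = d y * (W.ν y * W.avg f y) := by ring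
        simpa only [h6, h7] using h5
    exact h2.prod_fiberwise h4
  refine ⟨h3.summable, ?_⟩
  rw [h3.tsum_eq]
  refine (h1.hasSum.sub (W.hasSum_fst hfd)).congr_fun fun p => ?_
  ring

lemma hasSum_weight_sq {ρ : V → V → ℝ} {M₂ : ℝ}
    (hρ : ∀ y, Summable fun z => W.w y z * ρ y z ^ 2)
    (hM : ∀ y, ∑' z, W.w y z * ρ y z ^ 2 ≤ M₂ * W.ν y) {f : V → ℝ} (hf : ∀ y, 0 ≤ f y)
    (hfs : Summable fun y => W.ν y * f y) :
    Summable (fun p : V × V => W.w p.1 p.2 * ρ p.1 p.2 ^ 2 * f p.1) ∧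
      ∑' p : V × V, W.w p.1 p.2 * ρ p.1 p.2 ^ 2 * f p.1 ≤ M₂ * ∑' y, W.ν y * f y := by
  have hle : ∀ y, ∑' z, W.w y z * ρ y z ^ 2 * f y ≤ M₂ * (W.ν y * f y) := fun y => by
    rw [tsum_mul_right, ← mul_assoc]
    exact mul_le_mul_of_nonneg_right (hM y) (hf y)
  have hle' : Summable fun y => M₂ * (W.ν y * f y) := hfs.mul_left _
  have h0 : ∀ y z, 0 ≤ W.w y z * ρ y z ^ 2 * f y := fun y z =>
    mul_nonneg (mul_nonneg (W.nonneg _ _) (sq_nonneg _)) (hf _)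
  have hs : Summable (fun p : V × V => W.w p.1 p.2 * ρ p.1 p.2 ^ 2 * f p.1) := by
    rw [summable_prod_of_nonneg fun p => h0 _ _]
    exact ⟨fun y => (hρ y).mul_right (f y), Summable.of_nonneg_of_le
      (fun y => tsum_nonneg fun z => h0 _ _) hle hle'⟩
  refine ⟨hs, ?_⟩
  rw [hs.tsum_prod, ← tsum_mul_left]
  exact hs.prod.tsum_le_tsum hle hle'

/-- A priori bound on the growth of the first moment in one step. -/
lemma moment_le_add {d : V → ℝ} {ρ : V → V → ℝ} {M₂ : ℝ} (hd₀ : ∀ y, 0 ≤ d y)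
    (hd : ∀ y z, |d y - d z| ≤ ρ y z) (hρ : ∀ y, Summable fun z => W.w y z * ρ y z ^ 2)
    (hM : ∀ y, ∑' z, W.w y z * ρ y z ^ 2 ≤ M₂ * W.ν y) {f : V → ℝ} (hf : ∀ y, 0 ≤ f y)
    (hfs : HasSum (fun y => W.ν y * f y) 1) (hfd : Summable fun y => W.ν y * (f y * d y)) :
    ∑' y, W.ν y * (W.avg f y * d y) ≤ ∑' y, W.ν y * (f y * d y) + (1 + M₂) := by
  have h1 := (W.hasSum_moment_increment hd₀ hd hρ hM hf hfs.summable hfd).2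
  have h2 := W.hasSum_weight_sq hρ hM hf hfs.summable
  rw [hfs.tsum_eq, mul_one] at h2
  have h3 := W.hasSum_fst hfs.summable
  rw [hfs.tsum_eq] at h3
  have := hasSum_le (fun p => ?_) h1 (h3.add h2.1.hasSum)
  · linarith [h2.2]
  · have h4 : d p.2 - d p.1 ≤ 1 + ρ p.1 p.2 ^ 2 := by
      have := (abs_le.1 (hd p.1 p.2)).1
      nlinarith [sq_nonneg (ρ p.1 p.2 - 1)]
    have := mul_le_mul_of_nonneg_left (mul_le_mul_of_nonneg_right h4 (hf p.1)) (W.nonneg p.1 p.2)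
    linarith

/-- `x ↦ x log x` is uniformly convex when distances are measured through `√`. -/
lemma tangent_add_sq_sqrt_le_mul_log (a b : ℝ) (ha : 0 ≤ a) (hb : 0 < b) :
    b * Real.log b + (1 + Real.log b) * (a - b) + (√a - √b) ^ 2 ≤ a * Real.log a := by
  rcases ha.eq_or_lt with rfl | ha
  · have := Real.sq_sqrt hb.le
    simp only [Real.sqrt_zero, zero_sub, zero_mul]
    nlinarith
  have hsa := Real.sqrt_pos.2 ha
  have hsb := Real.sqrt_pos.2 hb
  have h1 : Real.log (√b / √a) ≤ √b / √a - 1 := Real.log_le_sub_one_of_pos (div_pos hsb hsa)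
  rw [Real.log_div hsb.ne' hsa.ne', Real.log_sqrt hb.le, Real.log_sqrt ha.le] at h1
  have h2 := mul_le_mul_of_nonneg_left h1 (by positivity : 0 ≤ 2 * (√a * √a))
  have h3 : 2 * (√a * √a) * (√b / √a - 1) = 2 * (√a * √b) - 2 * (√a * √a) := by
    field_simp
  rw [h3, Real.mul_self_sqrt ha.le] at h2
  have := Real.sq_sqrt ha.le
  have := Real.sq_sqrt hb.le
  nlinarith

/-- Nash's moment-entropy inequality: in one step the first moment increases by at most
`ε M₂ + (3 / 2ε) ΔQ` for any `ε > 0`, where `ΔQ` is the increase of the entropy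
`Q = -∑ ν f log f`. -/
lemma moment_le_entropy {d : V → ℝ} {ρ : V → V → ℝ} {M₂ : ℝ} (hd₀ : ∀ y, 0 ≤ d y)
    (hd : ∀ y z, |d y - d z| ≤ ρ y z) (hρs : ∀ y z, ρ y z = ρ z y)
    (hρ : ∀ y, Summable fun z => W.w y z * ρ y z ^ 2)
    (hM : ∀ y, ∑' z, W.w y z * ρ y z ^ 2 ≤ M₂ * W.ν y) {f : V → ℝ} (hf : ∀ y, 0 ≤ f y)
    (hfs : HasSum (fun y => W.ν y * f y) 1) (hfd : Summable fun y => W.ν y * (f y * d y))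
    (hlf : Summable fun y => W.ν y * (f y * Real.log (f y)))
    (hlg : Summable fun y => W.ν y * (W.avg f y * Real.log (W.avg f y))) {ε : ℝ} (hε : 0 < ε) :
    ∑' y, W.ν y * (W.avg f y * d y) ≤ ∑' y, W.ν y * (f y * d y) + (ε * M₂ +
      3 / (2 * ε) * (∑' y, W.ν y * (f y * Real.log (f y)) -
        ∑' y, W.ν y * (W.avg f y * Real.log (W.avg f y)))) := by
  have h1 := (W.hasSum_moment_increment hd₀ hd hρ hM hf hfs.summable hfd).2
  -- antisymmetrize the increment, so that it involves differences of `f`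
  have h1' : HasSum (fun p : V × V => W.w p.1 p.2 * ((d p.1 - d p.2) * f p.2))
      (∑' y, W.ν y * (W.avg f y * d y) - ∑' y, W.ν y * (f y * d y)) := by
    refine ((Equiv.prodComm V V).hasSum_iff.1 ?_)
    convert h1 using 2 with p
    simp [W.symm p.2 p.1]
  have h2 := W.hasSum_weight_sq hρ hM hf hfs.summable
  rw [hfs.tsum_eq, mul_one] at h2
  have h2' : HasSum (fun p : V × V => W.w p.1 p.2 * ρ p.1 p.2 ^ 2 * f p.2)
      (∑' p : V × V, W.w p.1 p.2 * ρ p.1 p.2 ^ 2 * f p.1) := by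
    refine ((Equiv.prodComm V V).hasSum_iff.1 ?_)
    convert h2.1.hasSum using 2 with p
    simp [W.symm p.2 p.1, hρs p.2 p.1]
  have h3 := W.gap (ψ := fun t => t * Real.log t) (ψ' := fun t => 1 + Real.log t) (χ := Real.sqrt)
    tangent_add_sq_sqrt_le_mul_log hf hfs.summable hlf hlg
  have := hasSum_le (fun p => ?_) (h1.add h1')
    (((h2.1.hasSum.add h2').mul_left ε).add (h3.1.hasSum.mul_left (1 / (2 * ε))))
  · have h4 := mul_le_mul_of_nonneg_left h3.2 (by positivity : 0 ≤ 1 / (2 * ε))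
    have h5 := mul_le_mul_of_nonneg_left h2.2 hε.le
    have h6 : ∀ x : ℝ, 1 / (2 * ε) * (6 * x) = 2 * (3 / (2 * ε) * x) := fun x => by ring
    rw [h6] at h4
    linarith
  · obtain ⟨y, z⟩ := p
    dsimp only
    have hy := Real.sq_sqrt (hf y)
    have hz := Real.sq_sqrt (hf z)
    have h0 := abs_le.1 (hd y z)
    have h4 : (d z - d y) * f y + (d y - d z) * f z ≤
        ε * (ρ y z ^ 2 * f y + ρ y z ^ 2 * f z) + 1 / (2 * ε) * (√(f z) - √(f y)) ^ 2 := by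
      set s := √(f y)
      set t := √(f z)
      have h5 : (d z - d y) * (s ^ 2 - t ^ 2) ≤
          ε / 2 * ((d z - d y) * (s + t)) ^ 2 + 1 / (2 * ε) * (t - s) ^ 2 := by
        have : 0 ≤ 1 / (2 * ε) * (ε * ((d z - d y) * (s + t)) + (t - s)) ^ 2 := by positivity
        have h7 : 1 / (2 * ε) * (ε * ((d z - d y) * (s + t)) + (t - s)) ^ 2 =
            ε / 2 * ((d z - d y) * (s + t)) ^ 2 + 1 / (2 * ε) * (t - s) ^ 2
              - (d z - d y) * (s ^ 2 - t ^ 2) := by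
          field_simp; ring
        linarith
      have h8 : (d z - d y) ^ 2 ≤ ρ y z ^ 2 := sq_le_sq' (by linarith) (by linarith)
      have h9 : (s + t) ^ 2 ≤ 2 * (s ^ 2 + t ^ 2) := by nlinarith [sq_nonneg (s - t)]
      have h10 : ((d z - d y) * (s + t)) ^ 2 ≤ ρ y z ^ 2 * (2 * (s ^ 2 + t ^ 2)) := by
        rw [mul_pow]
        exact mul_le_mul h8 h9 (sq_nonneg _) (sq_nonneg _)
      have h11 := mul_le_mul_of_nonneg_left h10 (by positivity : 0 ≤ ε / 2)
      rw [← hy, ← hz]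
      linarith
    have := mul_le_mul_of_nonneg_left h4 (W.nonneg y z)
    linarith

/-- Decay of the `ℓ²` norm: one step dissipates at least a multiple of the Dirichlet form. -/
lemma dirichlet_le {f : V → ℝ} (hf : ∀ y, 0 ≤ f y) (hfs : Summable fun y => W.ν y * f y)
    (h2f : Summable fun y => W.ν y * f y ^ 2) (h2g : Summable fun y => W.ν y * W.avg f y ^ 2) :
    Summable (fun p : V × V => W.w p.1 p.2 * (f p.2 - f p.1) ^ 2) ∧
      ∑' p : V × V, W.w p.1 p.2 * (f p.2 - f p.1) ^ 2 ≤
        6 * (∑' y, W.ν y * f y ^ 2 - ∑' y, W.ν y * W.avg f y ^ 2) :=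
  W.gap (ψ := fun t => t ^ 2) (ψ' := fun t => 2 * t) (χ := id)
    (fun a b _ _ => by simp only [id]; nlinarith) hf hfs h2f h2g

end LazyWeights

/-! ### Nash's inequality on the lattice, and lattice norms -/

section Translations

variable {d : ℕ}

lemma summable_sq_of_summable {V : Type*} {f : V → ℝ} (hf : ∀ y, 0 ≤ f y) (hs : Summable f) :
    Summable fun y => f y ^ 2 := by
  refine Summable.of_nonneg_of_le (fun y => sq_nonneg _) (fun y => ?_) (hs.mul_left (∑' y, f y))
  rw [sq]
  exact mul_le_mul_of_nonneg_right (hs.le_tsum y fun j _ => hf j) (hf y)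

lemma summable_sub_sq {V : Type*} {f g : V → ℝ} (hf : Summable fun y => f y ^ 2)
    (hg : Summable fun y => g y ^ 2) : Summable fun y => (f y - g y) ^ 2 :=
  Summable.of_nonneg_of_le (fun y => sq_nonneg _)
    (fun y => by nlinarith [sq_nonneg (f y + g y)]) ((hf.mul_left 2).add (hg.mul_left 2))

lemma summable_translate {f : IntLattice d → ℝ} (hf : Summable f) (z : IntLattice d) :
    Summable fun y => f (y + z) :=
  (Equiv.addRight z).summable_iff.2 hf

lemma tsum_translate (f : IntLattice d → ℝ) (z : IntLattice d) :
    ∑' y, f (y + z) = ∑' y, f y :=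
  (Equiv.addRight z).tsum_eq f

/-- Translating `f` by a vector of `ℓ¹` length `k` moves it in `ℓ²` by at most `k` times the largest
displacement under a unit translation. -/
lemma tsum_translate_sq_le {f : IntLattice d → ℝ} (hf : Summable fun y => f y ^ 2) {E : ℝ}
    (hE : ∀ i, ∑' y, (f y - f (y + Pi.single i 1)) ^ 2 ≤ E) (k : ℕ) :
    ∀ z : Fin d → ℕ, ∑ i, z i = k →
      ∑' y, (f y - f (y + fun i => (z i : ℤ))) ^ 2 ≤ (k : ℝ) ^ 2 * E := by
  have hsum : ∀ z : IntLattice d, Summable fun y => (f y - f (y + z)) ^ 2 := fun z =>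
    summable_sub_sq hf (summable_translate hf z)
  induction k with
  | zero =>
    intro z hz
    have : (fun i => (z i : ℤ)) = 0 := by
      ext i
      have := Finset.sum_eq_zero_iff.1 hz i (Finset.mem_univ i)
      simp [this]
    simp [this]
  | succ k ih =>
    intro z hz
    obtain ⟨i, hi⟩ : ∃ i, z i ≠ 0 := by
      by_contra! h
      simp [h] at hz
    set z' : Fin d → ℕ := fun j => z j - Pi.single (M := fun _ => ℕ) i 1 j with hz'
    have hzz : ∀ j, z j = z' j + Pi.single (M := fun _ => ℕ) i 1 j := fun j => by
      rcases eq_or_ne j i with rfl | h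
      · simp [hz']; omega
      · simp [hz', h]
    have hsz : ∑ j, z' j = k := by
      have : ∑ j, z j = ∑ j, z' j + 1 := by
        simp only [hzz, Finset.sum_add_distrib, Finset.sum_pi_single', Finset.mem_univ, if_true]
      omega
    have hcast : (fun j => (z j : ℤ)) = (fun j => (z' j : ℤ)) + Pi.single i 1 := by
      ext j
      rw [hzz j]
      rcases eq_or_ne j i with rfl | h
      · simp
      · simp [h]
    have h1 := ih z' hsz
    have h2 : ∑' y : IntLattice d, (f (y + fun j => (z' j : ℤ)) -
        f ((y + fun j => (z' j : ℤ)) + Pi.single i 1)) ^ 2 ≤ E :=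
      (tsum_translate (fun y : IntLattice d => (f y - f (y + Pi.single i 1)) ^ 2)
        (fun j => (z' j : ℤ))).trans_le (hE i)
    have hs1 := hsum (fun j => (z' j : ℤ))
    have hs2 : Summable fun y : IntLattice d =>
        (f (y + fun j => (z' j : ℤ)) - f ((y + fun j => (z' j : ℤ)) + Pi.single i 1)) ^ 2 :=
      summable_translate (hsum (Pi.single i 1)) _
    rw [hcast]
    simp only [← add_assoc]
    have hs3 := hsum ((fun j => (z' j : ℤ)) + Pi.single i 1)
    simp only [← add_assoc] at hs3
    rcases Nat.eq_zero_or_pos k with rfl | hk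
    · have hz0 : (fun j => (z' j : ℤ)) = 0 := by
        ext j
        have := Finset.sum_eq_zero_iff.1 hsz j (Finset.mem_univ j)
        simp [this]
      simpa [hz0] using hE i
    · have hk' : (0 : ℝ) < k := Nat.cast_pos.2 hk
      -- Young's inequality with weight `k`: `(1 + 1/k) k² + (1 + k) = (k + 1)²`
      have hpt : ∀ a b : ℝ, (a + b) ^ 2 ≤ (1 + 1 / k) * a ^ 2 + (1 + k) * b ^ 2 := fun a b => by
        have : 0 ≤ (a - k * b) ^ 2 / k := by positivity
        have h : (a - k * b) ^ 2 / k = (1 + 1 / k) * a ^ 2 + (1 + k) * b ^ 2 - (a + b) ^ 2 := by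
          field_simp; ring
        linarith
      have h3 := hs3.tsum_le_tsum (fun y => by
        have := hpt (f y - f (y + fun j => (z' j : ℤ)))
          (f (y + fun j => (z' j : ℤ)) - f ((y + fun j => (z' j : ℤ)) + Pi.single i 1))
        rwa [sub_add_sub_cancel] at this)
          ((hs1.mul_left (1 + 1 / (k : ℝ))).add (hs2.mul_left (1 + (k : ℝ))))
      rw [(hs1.mul_left _).tsum_add (hs2.mul_left _), tsum_mul_left, tsum_mul_left] at h3
      refine h3.trans ?_
      have h4 := mul_le_mul_of_nonneg_left h1 (by positivity : (0 : ℝ) ≤ 1 + 1 / k)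
      have h5 := mul_le_mul_of_nonneg_left h2 (by positivity : (0 : ℝ) ≤ 1 + k)
      refine (add_le_add h4 h5).trans (le_of_eq ?_)
      push_cast
      field_simp
      ring

/-- Nash's inequality on `ℤ^d`, in the form before optimizing over the scale `n`: compare `f` with
its averages over translates of the cube `[0, n)^d`. -/
lemma nash_inequality {f : IntLattice d → ℝ} (hf : ∀ y, 0 ≤ f y) (hs : Summable f) {E : ℝ}
    (hE : ∀ i, ∑' y, (f y - f (y + Pi.single i 1)) ^ 2 ≤ E) (hE₀ : 0 ≤ E) {n : ℕ} (hn : 0 < n) :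
    ∑' y, f y ^ 2 ≤ ((d : ℝ) * n) ^ 2 * E + 2 * (∑' y, f y) ^ 2 / (n : ℝ) ^ d := by
  have h2 := summable_sq_of_summable hf hs
  set τ : (Fin d → Fin n) → IntLattice d := fun z i => ((z i : ℕ) : ℤ) with hτ
  have hinj : Function.Injective τ := fun z z' h => by
    ext i
    have := congrFun h i
    simpa [hτ] using this
  have hsum : ∀ z : IntLattice d, Summable fun y => (f y - f (y + z)) ^ 2 := fun z =>
    summable_sub_sq h2 (summable_translate h2 z)
  have hle : ∀ y, f y ≤ ∑' y, f y := fun y => hs.le_tsum y fun j _ => hf j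
  have hprod : ∀ z : IntLattice d, Summable fun y => f y * f (y + z) := fun z =>
    Summable.of_nonneg_of_le (fun y => mul_nonneg (hf _) (hf _))
      (fun y => mul_le_mul_of_nonneg_left (hle _) (hf y)) (hs.mul_right _)
  have h3 : ∀ z : Fin d → Fin n,
      ∑' y, f y ^ 2 ≤ ((d : ℝ) * n) ^ 2 * E + 2 * ∑' y, f y * f (y + τ z) := fun z => by
    have h4 : ∑' y, (f y - f (y + τ z)) ^ 2 ≤ ((d : ℝ) * n) ^ 2 * E := by
      refine (tsum_translate_sq_le h2 hE _ (fun i => (z i : ℕ)) rfl).trans ?_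
      gcongr
      push_cast
      calc ∑ i, ((z i : ℕ) : ℝ) ≤ ∑ _i : Fin d, (n : ℝ) :=
            Finset.sum_le_sum fun i _ => Nat.cast_le.2 (z i).2.le
        _ = d * n := by simp
    have h5 := h2.tsum_le_tsum (fun y => by
      show f y ^ 2 ≤ (f y - f (y + τ z)) ^ 2 + 2 * (f y * f (y + τ z))
      nlinarith [sq_nonneg (f (y + τ z))]) ((hsum (τ z)).add ((hprod (τ z)).mul_left 2))
    rw [(hsum (τ z)).tsum_add ((hprod (τ z)).mul_left 2), tsum_mul_left] at h5
    linarith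
  have h6 : ∑ z : Fin d → Fin n, ∑' y, f y * f (y + τ z) ≤ (∑' y, f y) ^ 2 := by
    rw [← Summable.tsum_finsetSum fun z _ => hprod (τ z), sq, ← tsum_mul_right]
    refine (summable_sum fun z _ => hprod (τ z)).tsum_le_tsum (fun y => ?_) (hs.mul_right _)
    rw [← Finset.mul_sum]
    refine mul_le_mul_of_nonneg_left ?_ (hf y)
    have : ∑ z, f (y + τ z) =
        ∑ x ∈ Finset.univ.map ⟨fun z => y + τ z, fun a b h => hinj (add_left_cancel h)⟩, f x := by
      rw [Finset.sum_map]; rfl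
    rw [this]
    exact hs.sum_le_tsum _ fun j _ => hf j
  have h7 := Finset.sum_le_sum fun (z : Fin d → Fin n) (_ : z ∈ Finset.univ) => h3 z
  rw [Finset.sum_const, Finset.sum_add_distrib, Finset.sum_const, ← Finset.mul_sum,
    Finset.card_univ, Fintype.card_fun, Fintype.card_fin, Fintype.card_fin, nsmul_eq_mul,
    nsmul_eq_mul] at h7
  have hN : (0 : ℝ) < (n : ℝ) ^ d := by positivity
  push_cast at h7
  rw [← sub_le_iff_le_add', le_div_iff₀ hN]
  linarith

end Translations

section Norms

variable {d : ℕ}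

lemma abs_apply_le_latticeNorm (x : IntLattice d) (i : Fin d) : |(x i : ℝ)| ≤ latticeNorm x :=
  PiLp.norm_apply_le (WithLp.toLp 2 (fun i => (x i : ℝ)) : EuclideanSpace ℝ (Fin d)) i

lemma latticeNorm_single (i : Fin d) : latticeNorm (Pi.single i 1 : IntLattice d) = 1 := by
  have : (fun j => ((Pi.single i 1 : IntLattice d) j : ℝ)) = Pi.single i 1 := by
    ext j
    rcases eq_or_ne j i with rfl | h
    · simp
    · simp [h]
  rw [latticeNorm, this]
  simp

lemma latticeNorm_neg (x : IntLattice d) : latticeNorm (-x) = latticeNorm x := by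
  rw [latticeNorm, latticeNorm, ← norm_neg]
  congr 1
  ext i
  simp

lemma latticeNorm_sub_comm (x y : IntLattice d) : latticeNorm (x - y) = latticeNorm (y - x) := by
  rw [← latticeNorm_neg, neg_sub]

lemma latticeNorm_zero : latticeNorm (0 : IntLattice d) = 0 := by
  rw [latticeNorm, norm_eq_zero]
  ext i
  simp

lemma latticeNorm_add_le (x y : IntLattice d) :
    latticeNorm (x + y) ≤ latticeNorm x + latticeNorm y := by
  refine le_trans (le_of_eq ?_) (norm_add_le _ _)
  rw [latticeNorm]
  congr 1
  ext i
  simp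

/-- The `ℓ¹` norm of a lattice point. -/
noncomputable def l1Norm (x : IntLattice d) : ℝ := ∑ i, |(x i : ℝ)|

lemma l1Norm_nonneg (x : IntLattice d) : 0 ≤ l1Norm x := Finset.sum_nonneg fun _ _ => abs_nonneg _

lemma l1Norm_neg (x : IntLattice d) : l1Norm (-x) = l1Norm x := by simp [l1Norm]

lemma l1Norm_sub_comm (x y : IntLattice d) : l1Norm (x - y) = l1Norm (y - x) := by
  rw [← l1Norm_neg, neg_sub]

lemma l1Norm_add_le (x y : IntLattice d) : l1Norm (x + y) ≤ l1Norm x + l1Norm y := by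
  rw [l1Norm, l1Norm, l1Norm, ← Finset.sum_add_distrib]
  refine Finset.sum_le_sum fun i _ => ?_
  simpa using abs_add_le (x i : ℝ) (y i : ℝ)

lemma latticeNorm_le_l1Norm (x : IntLattice d) : latticeNorm x ≤ l1Norm x := by
  rw [latticeNorm, EuclideanSpace.norm_eq]
  refine Real.sqrt_le_iff.2 ⟨l1Norm_nonneg x, ?_⟩
  simp only [Real.norm_eq_abs]
  exact Finset.sum_sq_le_sq_sum_of_nonneg fun i _ => abs_nonneg _

/-- The sup norm of a lattice point. -/
def supNorm (x : IntLattice d) : ℕ := Finset.univ.sup fun i => (x i).natAbs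

lemma natAbs_le_supNorm (x : IntLattice d) (i : Fin d) : (x i).natAbs ≤ supNorm x :=
  Finset.le_sup (f := fun i => (x i).natAbs) (Finset.mem_univ i)

lemma l1Norm_le_supNorm (x : IntLattice d) : l1Norm x ≤ d * supNorm x := by
  calc l1Norm x ≤ ∑ _i : Fin d, (supNorm x : ℝ) := Finset.sum_le_sum fun i _ => by
        have : |(x i : ℝ)| = ((x i).natAbs : ℝ) := by
          rw [← Int.cast_abs, Int.abs_eq_natAbs, Int.cast_natCast]
        rw [this]
        exact Nat.cast_le.2 (natAbs_le_supNorm x i)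
    _ = d * supNorm x := by simp

lemma supNorm_le_latticeNorm (x : IntLattice d) : (supNorm x : ℝ) ≤ latticeNorm x := by
  have h0 : 0 ≤ latticeNorm x := norm_nonneg _
  rw [← Nat.le_floor_iff h0]
  refine Finset.sup_le fun i _ => Nat.le_floor ?_
  have : |(x i : ℝ)| = ((x i).natAbs : ℝ) := by
    rw [← Int.cast_abs, Int.abs_eq_natAbs, Int.cast_natCast]
  rw [← this]
  exact abs_apply_le_latticeNorm x i

lemma supNorm_pos {x : IntLattice d} (hx : x ≠ 0) : 0 < supNorm x := by
  obtain ⟨i, hi⟩ : ∃ i, x i ≠ 0 := by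
    by_contra! h
    exact hx (funext h)
  exact (Int.natAbs_pos.2 hi).trans_le (natAbs_le_supNorm x i)

end Norms

/-! ### Comparison of Dirichlet forms, and lattice sums -/

section Comparison

/-- A chain of steps inside a finite set `B`, each changing `f` by at most `s`, changes `f` by at most
`#B * s`, whatever its length: loops can be erased. -/
lemma abs_sub_le_card_mul {V : Type*} {B : Finset V} {r : V → V → Prop} {f : V → ℝ} {s : ℝ}
    (hs₀ : 0 ≤ s) (hs : ∀ u ∈ B, ∀ v ∈ B, r u v → |f u - f v| ≤ s) {z : ℕ → V} {N : ℕ} (hN : 1 ≤ N)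
    (hz : ∀ i, 1 ≤ i → i ≤ N → z i ∈ B) (hr : ∀ i, 1 ≤ i → i + 1 ≤ N → r (z i) (z (i + 1))) :
    |f (z 1) - f (z N)| ≤ B.card * s := by
  classical
  let G : SimpleGraph B := SimpleGraph.fromRel fun u v => r u v
  have hadj : ∀ u v : B, G.Adj u v → |f u - f v| ≤ s := fun u v h => by
    rcases ((SimpleGraph.fromRel_adj _ _ _).1 h).2 with h | h
    · exact hs u u.2 v v.2 h
    · rw [abs_sub_comm]; exact hs v v.2 u u.2 h
  have hwalk : ∀ (u v : B) (p : G.Walk u v), |f u - f v| ≤ p.length * s := by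
    intro u v p
    induction p with
    | nil => simp
    | @cons a b c h p ih =>
      have := abs_sub_le (f a) (f b) (f c)
      have := hadj a b h
      rw [SimpleGraph.Walk.length_cons]
      push_cast
      linarith
  have hreach : ∀ k (h1 : 1 ≤ k) (h2 : k ≤ N),
      G.Reachable ⟨z 1, hz 1 le_rfl hN⟩ ⟨z k, hz k h1 h2⟩ := by
    intro k h1
    induction k, h1 using Nat.le_induction with
    | base => intro _; exact SimpleGraph.Reachable.refl _
    | succ k h1 ih =>
      intro h2
      refine (ih (by omega)).trans ?_
      by_cases he : z k = z (k + 1)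
      · simp only [he]; exact SimpleGraph.Reachable.refl _
      · refine SimpleGraph.Adj.reachable ((SimpleGraph.fromRel_adj _ _ _).2 ⟨?_, Or.inl ?_⟩)
        · simpa using he
        · exact hr k h1 h2
  obtain ⟨p, hp⟩ := (hreach N hN le_rfl).exists_isPath
  refine (hwalk _ _ p).trans (mul_le_mul_of_nonneg_right ?_ hs₀)
  have := hp.length_lt
  rw [Fintype.card_coe] at this
  exact_mod_cast this.le

variable {d : ℕ}

/-- The box of lattice points at sup distance at most `M` from `0`. -/
noncomputable def originBox (d M : ℕ) : Finset (IntLattice d) :=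
  Fintype.piFinset fun _ => Finset.Icc (-(M : ℤ)) M

lemma card_originBox (d M : ℕ) : (originBox d M).card = (2 * M + 1) ^ d := by
  rw [originBox, Fintype.card_piFinset_const, Int.card_Icc]
  congr 1
  omega

/-- Under (A2) the nearest-neighbour Dirichlet form is bounded by a multiple of the Dirichlet form of
the conductances. -/
lemma Conductances.A2.nearest_neighbour_le {K : Conductances d} {M₀ δ : ℝ} (h : K.A2 M₀ δ)
    {f : IntLattice d → ℝ} (hf : Summable fun y => f y ^ 2)
    (hE : Summable fun p : IntLattice d × IntLattice d =>
      (K.C p.1 p.2 : ℝ) * (f p.2 - f p.1) ^ 2) (i : Fin d) :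
    ∑' y, (f y - f (y + Pi.single i 1)) ^ 2 ≤ (((2 * ⌈M₀⌉₊ + 1) ^ d : ℕ) : ℝ) ^ 3 / δ *
      ∑' p : IntLattice d × IntLattice d, (K.C p.1 p.2 : ℝ) * (f p.2 - f p.1) ^ 2 := by
  classical
  obtain ⟨hM, hδ, hA⟩ := h
  set M := ⌈M₀⌉₊
  set B := originBox d M with hB
  rw [← card_originBox, ← hB]
  set E : IntLattice d → ℝ := fun u => ∑' v, (K.C u v : ℝ) * (f v - f u) ^ 2 with hEdef
  have hEs : Summable E := hE.prod
  have hEt : ∑' u, E u = ∑' p : IntLattice d × IntLattice d,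
      (K.C p.1 p.2 : ℝ) * (f p.2 - f p.1) ^ 2 := hE.tsum_prod.symm
  have hE0 : ∀ u v, 0 ≤ (K.C u v : ℝ) * (f v - f u) ^ 2 := fun u v => by positivity
  have hEE : ∀ u v, (K.C u v : ℝ) * (f v - f u) ^ 2 ≤ E u := fun u v =>
    (hE.prod_factor u).le_tsum v fun w _ => hE0 u w
  have hEn : ∀ u, 0 ≤ E u := fun u => tsum_nonneg (hE0 u)
  have hpt : ∀ y, (f y - f (y + Pi.single i 1)) ^ 2 ≤
      (B.card : ℝ) ^ 2 / δ * ∑ o ∈ B, E (y + o) := fun y => by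
    set S := ∑ o ∈ B, E (y + o) with hS
    have hS0 : 0 ≤ S := Finset.sum_nonneg fun o _ => hEn _
    obtain ⟨N, z, hN, hz1, hzN, hzB, hzC⟩ := hA y (y + Pi.single i 1) (by
      rw [sub_add_cancel_left, latticeNorm_neg, latticeNorm_single])
    have hmem : ∀ u, u ∈ B.image (fun o => y + o) ↔ u - y ∈ B := fun u => by
      rw [Finset.mem_image]
      constructor
      · rintro ⟨o, ho, rfl⟩; simpa using ho
      · intro h; exact ⟨u - y, h, by simp⟩
    have key := abs_sub_le_card_mul (B := B.image fun o => y + o) (r := fun u v => δ ≤ K.C u v)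
      (f := f) (s := √(S / δ)) (Real.sqrt_nonneg _) (fun u hu v _ huv => by
        refine Real.abs_le_sqrt ?_
        rw [le_div_iff₀ hδ]
        have h1 : E u ≤ S := by
          have := Finset.single_le_sum (f := fun o => E (y + o)) (fun o _ => hEn _) ((hmem u).1 hu)
          simpa using this
        have h2 := hEE u v
        have h3 : δ * (f v - f u) ^ 2 ≤ K.C u v * (f v - f u) ^ 2 :=
          mul_le_mul_of_nonneg_right huv (sq_nonneg _)
        nlinarith) (z := z) (N := N) (by omega) (fun j h1 h2 => by
        rw [hmem, hB, originBox, Fintype.mem_piFinset]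
        intro k
        have h3 : latticeNorm (y - z j) < M₀ := hzB j h1 h2
        have h4 := (abs_apply_le_latticeNorm (y - z j) k).trans (h3.le.trans (Nat.le_ceil M₀))
        have h5 : |(y - z j) k| ≤ (M : ℤ) := by exact_mod_cast h4
        rw [abs_le] at h5
        rw [Finset.mem_Icc]
        simp only [Pi.sub_apply] at h5 ⊢
        omega) (fun j h1 h2 => hzC j h1 h2)
    rw [hz1, hzN, Finset.card_image_of_injective _ (add_right_injective y)] at key
    have h6 := pow_le_pow_left₀ (abs_nonneg _) key 2
    rw [sq_abs, mul_pow, Real.sq_sqrt (by positivity)] at h6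
    refine h6.trans (le_of_eq ?_)
    ring
  have hs : Summable fun y => ∑ o ∈ B, E (y + o) :=
    summable_sum fun o _ => summable_translate hEs o
  have h1 := (summable_sub_sq hf (summable_translate hf (Pi.single i 1))).tsum_le_tsum hpt
    (hs.mul_left _)
  rw [tsum_mul_left, Summable.tsum_finsetSum fun o _ => summable_translate hEs o] at h1
  simp only [tsum_translate E, Finset.sum_const, nsmul_eq_mul, hEt] at h1
  refine h1.trans (le_of_eq ?_)
  ring

end Comparison

section LatticeSums

variable {d : ℕ}

lemma card_supNorm_eq_le (u : Finset (IntLattice d)) {k : ℕ} (hk : 1 ≤ k) :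
    (((u.filter fun z => supNorm z = k).card : ℕ) : ℝ) * (k : ℝ) ^ 2 ≤
      2 * d * 3 ^ d * (k : ℝ) ^ (d + 1) := by
  classical
  set I : Finset ℤ := Finset.Icc (-(k : ℤ)) k
  set F : Fin d → Finset (IntLattice d) := fun i =>
    Fintype.piFinset (Function.update (fun _ => I) i {(k : ℤ), -(k : ℤ)})
  have hsub : (u.filter fun z => supNorm z = k) ⊆ Finset.univ.biUnion F := by
    intro z hz
    have hz := (Finset.mem_filter.1 hz).2
    have hne : (Finset.univ : Finset (Fin d)).Nonempty := by
      by_contra h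
      rw [Finset.not_nonempty_iff_eq_empty] at h
      rw [supNorm, h] at hz
      simp at hz
      omega
    obtain ⟨i, -, hi⟩ := Finset.exists_mem_eq_sup Finset.univ hne fun i => (z i).natAbs
    rw [Finset.mem_biUnion]
    refine ⟨i, Finset.mem_univ i, ?_⟩
    rw [Fintype.mem_piFinset]
    intro j
    rcases eq_or_ne j i with rfl | hj
    · rw [Function.update_self]
      have : (z j).natAbs = k := hi.symm.trans hz
      rw [Finset.mem_insert, Finset.mem_singleton]
      omega
    · rw [Function.update_of_ne hj]
      have := natAbs_le_supNorm z j
      rw [Finset.mem_Icc]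
      omega
  have hF : ∀ i, (F i).card ≤ 2 * (3 * k) ^ (d - 1) := fun i => by
    have hI : I.card ≤ 3 * k := by
      rw [Int.card_Icc]; omega
    have h2 : ({(k : ℤ), -(k : ℤ)} : Finset ℤ).card ≤ 2 := Finset.card_le_two
    rw [Fintype.card_piFinset]
    have : ∀ j, (Function.update (fun _ => I) i {(k : ℤ), -(k : ℤ)} j).card =
        Function.update (fun _ => I.card) i ({(k : ℤ), -(k : ℤ)} : Finset ℤ).card j := fun j => by
      rcases eq_or_ne j i with rfl | hj
      · simp
      · simp [hj]
    simp only [this]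
    rw [Finset.prod_update_of_mem (Finset.mem_univ i), Finset.prod_const]
    refine Nat.mul_le_mul h2 ?_
    rw [Finset.card_sdiff_of_subset (by simp), Finset.card_singleton, Finset.card_univ,
      Fintype.card_fin]
    exact Nat.pow_le_pow_left hI _
  have h1 : (u.filter fun z => supNorm z = k).card ≤ d * (2 * (3 * k) ^ (d - 1)) := by
    refine (Finset.card_le_card hsub).trans (Finset.card_biUnion_le.trans ?_)
    refine (Finset.sum_le_sum fun i _ => hF i).trans (le_of_eq ?_)
    simp
  have h2 : d * (2 * (3 * k) ^ (d - 1)) * k ^ 2 ≤ 2 * d * 3 ^ d * k ^ (d + 1) := by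
    rcases d with _ | d
    · simp
    · rw [Nat.add_sub_cancel, mul_pow]
      calc (d + 1) * (2 * (3 ^ d * k ^ d)) * k ^ 2 = 2 * (d + 1) * 3 ^ d * k ^ (d + 1 + 1) := by ring
        _ ≤ 2 * (d + 1) * 3 ^ (d + 1) * k ^ (d + 1 + 1) :=
          Nat.mul_le_mul_right _ (Nat.mul_le_mul_left _ (Nat.pow_le_pow_right (by norm_num)
            (Nat.le_succ d)))
  have h3 := (Nat.mul_le_mul_right (k ^ 2) h1).trans h2
  exact_mod_cast h3

/-- The radial function `|z|_∞² φ(|z|_∞)` on `ℤ^d` is summable under the moment condition in (A3),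
since the sup sphere of radius `k` has `O(k^{d-1})` points. -/
lemma sum_supNorm_le {φ : ℕ → ℝ} (h0 : ∀ i, 1 ≤ i → 0 ≤ φ i)
    (hs : Summable fun i : ℕ => (i : ℝ) ^ (d + 1) * φ i) (u : Finset (IntLattice d)) :
    ∑ z ∈ u, (supNorm z : ℝ) ^ 2 * φ (supNorm z) ≤
      2 * d * 3 ^ d * ∑' i : ℕ, (i : ℝ) ^ (d + 1) * φ i := by
  classical
  rw [Finset.sum_comp (fun k : ℕ => (k : ℝ) ^ 2 * φ k) supNorm, ← tsum_mul_left]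
  have hnn : ∀ i : ℕ, 0 ≤ 2 * d * 3 ^ d * ((i : ℝ) ^ (d + 1) * φ i) := fun i => by
    rcases Nat.eq_zero_or_pos i with rfl | hi
    · simp
    · have := h0 i hi
      positivity
  refine le_trans (Finset.sum_le_sum fun k _ => ?_)
    ((hs.mul_left (2 * d * 3 ^ d : ℝ)).sum_le_tsum _ fun i _ => hnn i)
  rcases Nat.eq_zero_or_pos k with rfl | hk
  · simp
  · rw [nsmul_eq_mul, ← mul_assoc, ← mul_assoc]
    exact mul_le_mul_of_nonneg_right (card_supNorm_eq_le u hk) (h0 k hk)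

/-- Under (A3) the jumps have second moments bounded in terms of `d` and `φ`. -/
lemma Conductances.A3.second_moment {K : Conductances d} {φ : ℕ → ℝ} (h : K.A3 φ)
    (x : IntLattice d) :
    Summable (fun y => (K.C x y : ℝ) * l1Norm (x - y) ^ 2) ∧
      ∑' y, (K.C x y : ℝ) * l1Norm (x - y) ^ 2 ≤
        (d : ℝ) ^ 2 * (2 * d * 3 ^ d * ∑' i : ℕ, (i : ℝ) ^ (d + 1) * φ i) := by
  classical
  obtain ⟨h0, hanti, hs, -, hC⟩ := h
  have hpt : ∀ y, (K.C x y : ℝ) * l1Norm (x - y) ^ 2 ≤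
      (d : ℝ) ^ 2 * ((supNorm (x - y) : ℝ) ^ 2 * φ (supNorm (x - y))) := fun y => by
    rcases eq_or_ne x y with rfl | hxy
    · have : supNorm (x - x) = 0 := by
        rw [sub_self]; simp [supNorm]
      rw [this, K.diag]; simp
    · have hpos := supNorm_pos (sub_ne_zero.2 hxy)
      have h1 : (K.C x y : ℝ) ≤ φ (supNorm (x - y)) :=
        (hC x y hxy).trans (hanti _ _ hpos (Nat.le_floor (supNorm_le_latticeNorm _)))
      have h2 : l1Norm (x - y) ^ 2 ≤ (d * supNorm (x - y)) ^ 2 :=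
        pow_le_pow_left₀ (l1Norm_nonneg _) (l1Norm_le_supNorm _) 2
      calc _ ≤ φ (supNorm (x - y)) * (d * supNorm (x - y)) ^ 2 :=
            mul_le_mul h1 h2 (sq_nonneg _) (h0 _ hpos)
        _ = _ := by ring
  have hfin : ∀ u : Finset (IntLattice d), ∑ y ∈ u, (K.C x y : ℝ) * l1Norm (x - y) ^ 2 ≤
      (d : ℝ) ^ 2 * (2 * d * 3 ^ d * ∑' i : ℕ, (i : ℝ) ^ (d + 1) * φ i) := fun u => by
    refine (Finset.sum_le_sum fun y _ => hpt y).trans ?_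
    rw [← Finset.mul_sum]
    refine mul_le_mul_of_nonneg_left ?_ (sq_nonneg _)
    have := sum_supNorm_le h0 hs (u.map ⟨fun y => x - y, sub_right_injective⟩)
    rwa [Finset.sum_map] at this
  have hnn : ∀ y, 0 ≤ (K.C x y : ℝ) * l1Norm (x - y) ^ 2 := fun y => by positivity
  have hsum := summable_of_sum_le hnn hfin
  exact ⟨hsum, hsum.tsum_le_of_sum_le hfin⟩

lemma sum_pow_natAbs_le {r : ℝ} (h0 : 0 ≤ r) (h1 : r < 1) (t : Finset ℤ) :
    ∑ k ∈ t, r ^ k.natAbs ≤ 2 / (1 - r) := by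
  classical
  rw [Finset.sum_comp (fun n : ℕ => r ^ n) Int.natAbs, div_eq_mul_inv,
    ← tsum_geometric_of_lt_one h0 h1, ← tsum_mul_left]
  refine le_trans (Finset.sum_le_sum fun n _ => ?_)
    (((summable_geometric_of_lt_one h0 h1).mul_left 2).sum_le_tsum _ fun i _ => by positivity)
  rw [nsmul_eq_mul]
  refine mul_le_mul_of_nonneg_right ?_ (by positivity)
  have : (t.filter fun k => k.natAbs = n) ⊆ {(n : ℤ), -(n : ℤ)} := fun k hk => by
    have := (Finset.mem_filter.1 hk).2
    rw [Finset.mem_insert, Finset.mem_singleton]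
    omega
  exact_mod_cast (Finset.card_le_card this).trans Finset.card_le_two

/-- `∑_z exp(-λ |z|₁) ≤ (4/λ)^d` for `0 < λ ≤ 1`. -/
lemma exp_l1Norm_sum {lam : ℝ} (h0 : 0 < lam) (h1 : lam ≤ 1) :
    Summable (fun z : IntLattice d => Real.exp (-(lam * l1Norm z))) ∧
      ∑' z : IntLattice d, Real.exp (-(lam * l1Norm z)) ≤ (4 / lam) ^ d := by
  classical
  set r := Real.exp (-lam) with hr
  have hr0 : 0 ≤ r := (Real.exp_pos _).le
  have hr1 : r < 1 := by
    simpa [hr] using h0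
  have hr2 : 2 / (1 - r) ≤ 4 / lam := by
    have h2 : r * (1 + lam) ≤ 1 := by
      have := Real.add_one_le_exp lam
      calc r * (1 + lam) ≤ r * Real.exp lam := mul_le_mul_of_nonneg_left (by linarith) hr0
        _ = 1 := by rw [hr, ← Real.exp_add]; simp
    rw [div_le_div_iff₀ (by linarith) h0]
    nlinarith
  have heq : ∀ z : IntLattice d, Real.exp (-(lam * l1Norm z)) = ∏ i, r ^ (z i).natAbs := fun z => by
    rw [l1Norm, Finset.mul_sum, ← Finset.sum_neg_distrib, Real.exp_sum]
    refine Finset.prod_congr rfl fun i _ => ?_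
    have : |(z i : ℝ)| = ((z i).natAbs : ℝ) := by
      rw [← Int.cast_abs, Int.abs_eq_natAbs, Int.cast_natCast]
    rw [this, hr, ← Real.exp_nat_mul]
    congr 1; ring
  have hfin : ∀ u : Finset (IntLattice d),
      ∑ z ∈ u, Real.exp (-(lam * l1Norm z)) ≤ (4 / lam) ^ d := fun u => by
    have hsub : u ⊆ Fintype.piFinset fun i => u.image fun z => z i := fun z hz => by
      rw [Fintype.mem_piFinset]
      exact fun i => Finset.mem_image_of_mem _ hz
    refine (Finset.sum_le_sum_of_subset_of_nonneg hsub fun z _ _ => (Real.exp_pos _).le).trans ?_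
    simp only [heq]
    rw [← Finset.prod_univ_sum (fun i => u.image fun z => z i) fun _ k => r ^ k.natAbs]
    refine (Finset.prod_le_prod (fun i _ => Finset.sum_nonneg fun _ _ => pow_nonneg hr0 _)
      fun i _ => (sum_pow_natAbs_le hr0 hr1 _).trans hr2).trans (le_of_eq ?_)
    rw [Finset.prod_const, Finset.card_univ, Fintype.card_fin]
  have hsum := summable_of_sum_le (fun z => (Real.exp_pos _).le) hfin
  exact ⟨hsum, hsum.tsum_le_of_sum_le hfin⟩

end LatticeSums

/-! ### Recursions for the decay and for the moment, and bounds on the entropy -/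

section Recursions

/-- A nonincreasing sequence dissipating according to Nash's inequality decays like `m^{-d/2}`. -/
lemma exists_decay_bound (d : ℕ) {K₁ K₂ U : ℝ} (hK₁ : 0 ≤ K₁) (hK₂ : 0 ≤ K₂) :
    ∃ R : ℝ, 0 < R ∧ ∀ u : ℕ → ℝ, (∀ m, 0 ≤ u m) → (∀ m, u (m + 1) ≤ u m) → (∀ m, u m ≤ U) →
      (∀ m n : ℕ, 0 < n → u m ≤ K₁ * (n : ℝ) ^ 2 * (u m - u (m + 1)) + K₂ / (n : ℝ) ^ d) →
      ∀ m : ℕ, u m * √m ^ d ≤ R := by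
  obtain ⟨ε, hε0, hε1, hε2⟩ : ∃ ε : ℝ, 0 < ε ∧ ε ≤ 1 / 2 ∧ 8 * K₁ * ε ^ 2 * 2 ^ d ≤ 1 / 2 := by
    refine ⟨1 / (8 * (K₁ + 1) * 2 ^ d), by positivity, ?_, ?_⟩
    · have : (1 : ℝ) ≤ 2 ^ d := one_le_pow₀ (by norm_num)
      rw [div_le_div_iff₀ (by positivity) (by norm_num)]
      nlinarith
    · have h2 : (1 : ℝ) ≤ 2 ^ d := one_le_pow₀ (by norm_num)
      rw [div_pow, one_pow, mul_one_div, div_mul_eq_mul_div, div_le_div_iff₀ (by positivity)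
        (by norm_num)]
      have h3 : K₁ ≤ (K₁ + 1) ^ 2 := by nlinarith
      have h4 : K₁ * 2 ^ d ≤ (K₁ + 1) ^ 2 * 2 ^ d * 2 ^ d := by
        have h5 : K₁ * 2 ^ d ≤ (K₁ + 1) ^ 2 * 2 ^ d :=
          mul_le_mul_of_nonneg_right h3 (by positivity)
        have h6 : (0 : ℝ) ≤ (K₁ + 1) ^ 2 * 2 ^ d := by positivity
        nlinarith
      nlinarith
  refine ⟨|U| / ε ^ d + 2 * (K₂ / ε ^ d) + 1, by positivity, fun u h0 hanti hU hN => ?_⟩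
  set R := |U| / ε ^ d + 2 * (K₂ / ε ^ d) + 1 with hR
  intro m
  induction m using Nat.strong_induction_on with
  | _ m ih =>
  set s := √(m : ℝ) with hs
  have hs0 : 0 ≤ s := Real.sqrt_nonneg _
  have hss : s ^ 2 = m := Real.sq_sqrt (Nat.cast_nonneg m)
  rcases lt_or_ge (ε * s) 1 with hlt | hge
  · have h1 : s ^ d ≤ 1 / ε ^ d := by
      rw [le_div_iff₀ (by positivity), ← mul_pow]
      exact pow_le_one₀ (by positivity) (by linarith)
    calc u m * s ^ d ≤ |U| * (1 / ε ^ d) :=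
          mul_le_mul ((hU m).trans (le_abs_self U)) h1 (by positivity) (abs_nonneg U)
      _ = |U| / ε ^ d := by ring
      _ ≤ R := by
        have : 0 ≤ K₂ / ε ^ d := by positivity
        linarith
  · have hs2 : 2 ≤ s := by nlinarith
    have hm4 : 4 ≤ m := by
      have : (4 : ℝ) ≤ m := by nlinarith
      exact_mod_cast this
    set T := m / 2 with hT
    set n := ⌈ε * s⌉₊ with hn
    have hn0 : 0 < n := Nat.ceil_pos.2 (by linarith)
    have hn1 : ε * s ≤ n := Nat.le_ceil _
    have hn2 : (n : ℝ) ≤ 2 * (ε * s) := by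
      have := Nat.ceil_lt_add_one (by linarith : 0 ≤ ε * s)
      linarith
    have htel : ∀ k : ℕ, (k : ℝ) * u (T + k) ≤
        K₁ * (n : ℝ) ^ 2 * (u T - u (T + k)) + k * (K₂ / (n : ℝ) ^ d) := by
      intro k
      induction k with
      | zero => simp
      | succ k ihk =>
        have h1 := hN (T + k) n hn0
        have h2 := hanti (T + k)
        have h3 : ((k : ℝ) + 1) * u (T + k + 1) ≤ (k + 1) * u (T + k) :=
          mul_le_mul_of_nonneg_left h2 (by positivity)
        rw [← add_assoc]
        push_cast
        linarith
    obtain ⟨k, hk⟩ : ∃ k, m = T + k := ⟨m - T, by omega⟩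
    have hk2 : (m : ℝ) ≤ 2 * k := by
      have : m ≤ 2 * k := by omega
      exact_mod_cast this
    have hk0 : (0 : ℝ) < k := by
      have : 0 < k := by omega
      exact_mod_cast this
    have h1 := htel k
    rw [← hk] at h1
    have hTs : s ≤ 2 * √(T : ℝ) := by
      rw [hs]
      refine Real.sqrt_le_iff.2 ⟨by positivity, ?_⟩
      rw [mul_pow, Real.sq_sqrt (Nat.cast_nonneg T)]
      have : m ≤ 4 * T := by omega
      have : (m : ℝ) ≤ 4 * T := by exact_mod_cast this
      linarith
    have h2 : u T * s ^ d ≤ 2 ^ d * R := by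
      calc u T * s ^ d ≤ u T * (2 * √(T : ℝ)) ^ d :=
            mul_le_mul_of_nonneg_left (pow_le_pow_left₀ hs0 hTs d) (h0 T)
        _ = 2 ^ d * (u T * √(T : ℝ) ^ d) := by rw [mul_pow]; ring
        _ ≤ 2 ^ d * R := mul_le_mul_of_nonneg_left (ih T (by omega)) (by positivity)
    have h3 : (n : ℝ) ^ 2 ≤ 8 * ε ^ 2 * k := by
      calc (n : ℝ) ^ 2 ≤ (2 * (ε * s)) ^ 2 := pow_le_pow_left₀ (by positivity) hn2 2
        _ = 4 * ε ^ 2 * m := by rw [← hss]; ring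
        _ ≤ 4 * ε ^ 2 * (2 * k) := mul_le_mul_of_nonneg_left hk2 (by positivity)
        _ = _ := by ring
    have h4 : s ^ d / (n : ℝ) ^ d ≤ 1 / ε ^ d := by
      rw [div_le_div_iff₀ (by positivity) (by positivity), one_mul, mul_comm, ← mul_pow]
      exact pow_le_pow_left₀ (by positivity) hn1 d
    have h5 : (k : ℝ) * (u m * s ^ d) ≤ k * (R / 2 + K₂ / ε ^ d) := by
      have h6 : (k : ℝ) * u m ≤ K₁ * (8 * ε ^ 2 * k) * u T + k * (K₂ / (n : ℝ) ^ d) := by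
        have h7 : K₁ * (n : ℝ) ^ 2 * (u T - u m) ≤ K₁ * (n : ℝ) ^ 2 * u T :=
          mul_le_mul_of_nonneg_left (by linarith [h0 m]) (by positivity)
        have h8 : K₁ * (n : ℝ) ^ 2 * u T ≤ K₁ * (8 * ε ^ 2 * k) * u T :=
          mul_le_mul_of_nonneg_right (mul_le_mul_of_nonneg_left h3 hK₁) (h0 T)
        linarith
      calc (k : ℝ) * (u m * s ^ d) = k * u m * s ^ d := by ring
        _ ≤ (K₁ * (8 * ε ^ 2 * k) * u T + k * (K₂ / (n : ℝ) ^ d)) * s ^ d :=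
          mul_le_mul_of_nonneg_right h6 (by positivity)
        _ = k * (8 * K₁ * ε ^ 2 * (u T * s ^ d) + K₂ * (s ^ d / (n : ℝ) ^ d)) := by ring
        _ ≤ k * (8 * K₁ * ε ^ 2 * (2 ^ d * R) + K₂ * (1 / ε ^ d)) := by gcongr
        _ = k * (8 * K₁ * ε ^ 2 * 2 ^ d * R + K₂ / ε ^ d) := by ring
        _ ≤ k * (1 / 2 * R + K₂ / ε ^ d) := by
          have : 0 ≤ R := by positivity
          gcongr
        _ = _ := by ring
    have h6 := le_of_mul_le_mul_left h5 hk0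
    have : 0 ≤ |U| / ε ^ d := by positivity
    linarith

/-- Nash's argument that the first moment is diffusive. The increase of `M` between `m / 4` and `m` is
at most `√m` times the increase of `Q`, up to constants, and the latter is at most logarithmic in
`M m / √m`; so `M m / √m` cannot grow. -/
lemma exists_moment_bound (d : ℕ) {a b c R : ℝ} (ha : 0 ≤ a) (hb : 0 ≤ b) :
    ∃ S : ℝ, 0 < S ∧ ∀ M Q : ℕ → ℝ, (∀ m, 0 ≤ M m) → M 0 = 0 → (∀ m, M (m + 1) ≤ M m + a) →
      (∀ m, ∀ ε : ℝ, 0 < ε → M (m + 1) ≤ M m + (ε * b + 3 / (2 * ε) * (Q (m + 1) - Q m))) →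
      (∀ m, Q m ≤ d * Real.log (M m + 1) + c) →
      (∀ m : ℕ, 1 ≤ m → d * Real.log √(m : ℝ) - R ≤ Q m) →
      ∀ m, 1 ≤ m → M m + 1 ≤ S * √m := by
  set η : ℝ := 1 / (6 * (d + 1)) with hη
  have hη0 : 0 < η := by positivity
  have hη1 : 3 / 2 * (d * η) ≤ 1 / 4 := by
    rw [hη, mul_one_div, mul_div_assoc', div_le_div_iff₀ (by positivity) (by norm_num)]
    linarith
  set c₂ : ℝ := 6 * b + 3 / 2 * (c + R) + 3 / 2 * (d * (-1 - Real.log η)) with hc₂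
  refine ⟨3 * a + 1 + 2 * |c₂|, by positivity, fun M Q hM0 hMz hMa hMQ hQ1 hQ2 => ?_⟩
  set S := 3 * a + 1 + 2 * |c₂| with hS
  intro m
  induction m using Nat.strong_induction_on with
  | _ m ih =>
  intro hm
  rcases lt_or_ge m 4 with hlt | hge
  · have hlin : ∀ k : ℕ, M k ≤ k * a := by
      intro k
      induction k with
      | zero => simp [hMz]
      | succ k ihk =>
        have := hMa k
        push_cast
        linarith
    have h1 := hlin m
    have h2 : (m : ℝ) ≤ 3 := by
      have : m ≤ 3 := by omega
      exact_mod_cast this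
    have h3 : (1 : ℝ) ≤ √m := Real.one_le_sqrt.2 (by exact_mod_cast hm)
    have h4 : (m : ℝ) * a ≤ 3 * a := mul_le_mul_of_nonneg_right h2 ha
    have h5 : S ≤ S * √m := le_mul_of_one_le_right (by positivity) h3
    have := abs_nonneg c₂
    linarith
  · set T := m / 4 with hT
    have hT1 : 1 ≤ T := by omega
    have hT0 : (0 : ℝ) < T := by exact_mod_cast hT1
    obtain ⟨k, hk⟩ : ∃ k, m = T + k := ⟨m - T, by omega⟩
    set t := √(T : ℝ) with ht
    have ht0 : 0 < t := Real.sqrt_pos.2 hT0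
    have htt : t ^ 2 = T := Real.sq_sqrt hT0.le
    have htel : ∀ k : ℕ, M (T + k) ≤
        M T + (k * (1 / t * b) + 3 / (2 * (1 / t)) * (Q (T + k) - Q T)) := by
      intro k
      induction k with
      | zero => simp
      | succ k ihk =>
        have := hMQ (T + k) (1 / t) (by positivity)
        rw [← add_assoc]
        push_cast
        linarith
    have h1 := htel k
    rw [← hk] at h1
    have h2 : 3 / (2 * (1 / t)) = 3 / 2 * t := by field_simp
    have h3 : (k : ℝ) * (1 / t * b) ≤ 6 * b * t := by
      have h4 : (k : ℝ) ≤ 6 * t ^ 2 := by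
        rw [htt]
        have : k ≤ 6 * T := by omega
        exact_mod_cast this
      calc (k : ℝ) * (1 / t * b) ≤ 6 * t ^ 2 * (1 / t * b) :=
            mul_le_mul_of_nonneg_right h4 (by positivity)
        _ = _ := by field_simp
    rw [h2] at h1
    have h5 := hQ1 m
    have h6 := hQ2 T hT1
    set v := (M m + 1) / t with hv
    have hMm : 0 < M m + 1 := by linarith [hM0 m]
    have hv0 : 0 < v := by positivity
    have hvt : M m + 1 = v * t := by rw [hv]; field_simp
    have h7 : Real.log (M m + 1) = Real.log v + Real.log t := by
      rw [hvt, Real.log_mul hv0.ne' ht0.ne']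
    have h8 : Q m - Q T ≤ d * Real.log v + (c + R) := by
      rw [h7] at h5
      linarith
    have h9 : Real.log v ≤ η * v - 1 - Real.log η := by
      have := Real.log_le_sub_one_of_pos (mul_pos hη0 hv0)
      rw [Real.log_mul hη0.ne' hv0.ne'] at this
      linarith
    have h10 := ih T (by omega) hT1
    have h11 : v * t ≤ (S + c₂ + 1 / 4 * v) * t := by
      have h12 := mul_le_mul_of_nonneg_left h8 (by positivity : 0 ≤ 3 / 2 * t)
      have h13 := mul_le_mul_of_nonneg_left h9 (by positivity : 0 ≤ 3 / 2 * t * d)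
      have h14 := mul_le_mul_of_nonneg_right hη1 (by positivity : 0 ≤ v * t)
      rw [← hvt]
      rw [hc₂]
      linarith
    have h12 := le_of_mul_le_mul_right h11 ht0
    have h13 : v ≤ 4 / 3 * (S + |c₂|) := by linarith [le_abs_self c₂]
    have h14 : t ≤ √m / 2 := by
      rw [le_div_iff₀ (by norm_num)]
      refine Real.le_sqrt_of_sq_le ?_
      rw [mul_pow, htt]
      have : T * 4 ≤ m := by omega
      have : (T : ℝ) * 4 ≤ m := by exact_mod_cast this
      linarith
    rw [hvt]
    calc v * t ≤ 4 / 3 * (S + |c₂|) * (√m / 2) := mul_le_mul h13 h14 ht0.le (by positivity)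
      _ ≤ S * √m := by
        have h15 : S + |c₂| ≤ 3 / 2 * S := by linarith
        have := mul_le_mul_of_nonneg_right h15 (Real.sqrt_nonneg (m : ℝ))
        linarith

end Recursions

section Entropy

variable {d : ℕ} (W : LazyWeights (IntLattice d))

lemma neg_mul_log_le {t : ℝ} (ht : 0 ≤ t) (a : ℝ) :
    -(t * Real.log t) ≤ t * a + Real.exp (-a - 1) := by
  rcases ht.eq_or_lt with rfl | ht
  · simpa using (Real.exp_pos _).le
  · have h := Real.log_le_sub_one_of_pos (div_pos (Real.exp_pos (-a - 1)) ht)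
    rw [Real.log_div (Real.exp_pos _).ne' ht.ne', Real.log_exp] at h
    have h2 := mul_le_mul_of_nonneg_left h ht.le
    have h3 : t * (Real.exp (-a - 1) / t - 1) = Real.exp (-a - 1) - t := by field_simp
    rw [h3] at h2
    linarith

lemma LazyWeights.apply_le_inv {V : Type*} (W : LazyWeights V) {c₁ : ℝ} (hc₁ : 0 < c₁)
    (hν : ∀ y, c₁ ≤ W.ν y) {f : V → ℝ}
    (hf : ∀ y, 0 ≤ f y) (hfs : HasSum (fun y => W.ν y * f y) 1) (y : V) : f y ≤ 1 / c₁ := by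
  have := le_hasSum hfs y fun j _ => mul_nonneg (W.pos j).le (hf j)
  rw [le_div_iff₀ hc₁, mul_comm]
  exact (mul_le_mul_of_nonneg_right (hν y) (hf y)).trans this

lemma summable_exp_l1Norm_sub {lam : ℝ} (h0 : 0 < lam) (h1 : lam ≤ 1) (x : IntLattice d) :
    Summable (fun y => Real.exp (-(lam * l1Norm (x - y)))) ∧
      ∑' y, Real.exp (-(lam * l1Norm (x - y))) ≤ (4 / lam) ^ d := by
  have h := exp_l1Norm_sum (d := d) h0 h1
  exact ⟨(Equiv.subLeft x).summable_iff.2 h.1,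
    ((Equiv.subLeft x).tsum_eq fun z => Real.exp (-(lam * l1Norm z))).trans_le h.2⟩

lemma LazyWeights.summable_mul_log {c₁ c₂ : ℝ} (hc₁ : 0 < c₁) (hν : ∀ y, c₁ ≤ W.ν y)
    (hν₂ : ∀ y, W.ν y ≤ c₂) {f : IntLattice d → ℝ} (hf : ∀ y, 0 ≤ f y)
    (hfs : HasSum (fun y => W.ν y * f y) 1) {x : IntLattice d}
    (hfd : Summable fun y => W.ν y * (f y * l1Norm (x - y))) :
    Summable fun y => W.ν y * (f y * Real.log (f y)) := by
  have he := (summable_exp_l1Norm_sub one_pos le_rfl x).1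
  refine Summable.of_norm_bounded
    ((hfd.add (he.mul_left c₂)).add (hfs.summable.mul_left |Real.log (1 / c₁)|)) fun y => ?_
  have hn := (W.pos y).le
  have hd := l1Norm_nonneg (x - y)
  have h1 : f y * Real.log (f y) ≤ f y * |Real.log (1 / c₁)| := by
    rcases (hf y).eq_or_lt with h | h
    · simp [← h]
    · exact mul_le_mul_of_nonneg_left
        ((Real.log_le_log h (W.apply_le_inv hc₁ hν hf hfs y)).trans (le_abs_self _)) h.le
  have h2 := neg_mul_log_le (hf y) (l1Norm (x - y))
  have h3 : Real.exp (-l1Norm (x - y) - 1) ≤ Real.exp (-(1 * l1Norm (x - y))) :=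
    Real.exp_le_exp.2 (by linarith)
  have h4 : |f y * Real.log (f y)| ≤ f y * l1Norm (x - y) + Real.exp (-(1 * l1Norm (x - y))) +
      f y * |Real.log (1 / c₁)| := by
    have := mul_nonneg (hf y) hd
    have := mul_nonneg (hf y) (abs_nonneg (Real.log (1 / c₁)))
    have := Real.exp_pos (-(1 * l1Norm (x - y)))
    rw [abs_le]
    constructor <;> linarith
  rw [norm_mul, Real.norm_of_nonneg hn, Real.norm_eq_abs]
  have h5 := mul_le_mul_of_nonneg_left h4 hn
  have h6 := mul_le_mul_of_nonneg_right (hν₂ y) (Real.exp_pos (-(1 * l1Norm (x - y)))).le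
  linarith

/-- Among densities with first moment `M` the entropy is at most `d log (M + 1)`, up to a constant. -/
lemma LazyWeights.entropy_le {c₁ c₂ : ℝ} (hc₁ : 0 < c₁) (hν : ∀ y, c₁ ≤ W.ν y)
    (hν₂ : ∀ y, W.ν y ≤ c₂) {f : IntLattice d → ℝ} (hf : ∀ y, 0 ≤ f y)
    (hfs : HasSum (fun y => W.ν y * f y) 1) {x : IntLattice d}
    (hfd : Summable fun y => W.ν y * (f y * l1Norm (x - y))) :
    -∑' y, W.ν y * (f y * Real.log (f y)) ≤
      d * Real.log (∑' y, W.ν y * (f y * l1Norm (x - y)) + 1) + (1 + c₂ * 4 ^ d) := by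
  have hl := W.summable_mul_log hc₁ hν hν₂ hf hfs hfd
  set M := ∑' y, W.ν y * (f y * l1Norm (x - y)) with hM
  have hM0 : 0 ≤ M := tsum_nonneg fun y =>
    mul_nonneg (W.pos y).le (mul_nonneg (hf y) (l1Norm_nonneg _))
  have hc₂ : 0 < c₂ := (W.pos x).trans_le (hν₂ x)
  set lam := 1 / (M + 1) with hlam
  have hlam0 : 0 < lam := by positivity
  have hlam1 : lam ≤ 1 := by rw [hlam, div_le_one (by positivity)]; linarith
  set b := d * Real.log (M + 1) with hb
  have he := summable_exp_l1Norm_sub hlam0 hlam1 x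
  -- test the entropy against the weight `exp (-lam |x - y|₁) / (M + 1)^d`
  have hpt : ∀ y, -(W.ν y * (f y * Real.log (f y))) ≤
      lam * (W.ν y * (f y * l1Norm (x - y))) + b * (W.ν y * f y) +
        c₂ * Real.exp (-b) * Real.exp (-(lam * l1Norm (x - y))) := fun y => by
    have h1 := neg_mul_log_le (hf y) (lam * l1Norm (x - y) + b)
    have h2 : Real.exp (-(lam * l1Norm (x - y) + b) - 1) ≤
        Real.exp (-b) * Real.exp (-(lam * l1Norm (x - y))) := by
      rw [← Real.exp_add]
      exact Real.exp_le_exp.2 (by linarith)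
    have h3 := mul_le_mul_of_nonneg_left (h1.trans (add_le_add_right h2 _)) (W.pos y).le
    have h4 := mul_le_mul_of_nonneg_right (hν₂ y)
      (by positivity : 0 ≤ Real.exp (-b) * Real.exp (-(lam * l1Norm (x - y))))
    linarith
  have hR := ((hfd.hasSum.mul_left lam).add (hfs.mul_left b)).add
    (he.1.hasSum.mul_left (c₂ * Real.exp (-b)))
  have h5 := hasSum_le hpt hl.hasSum.neg hR
  rw [← hM, mul_one] at h5
  have h6 : lam * M ≤ 1 := by
    rw [hlam, one_div, inv_mul_le_iff₀ (by positivity)]; linarith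
  have h7 : c₂ * Real.exp (-b) * ∑' y, Real.exp (-(lam * l1Norm (x - y))) ≤ c₂ * 4 ^ d := by
    have h8 : Real.exp (-b) = 1 / (M + 1) ^ d := by
      rw [hb, Real.exp_neg, Real.exp_nat_mul, Real.exp_log (by positivity), one_div]
    refine (mul_le_mul_of_nonneg_left he.2 (by positivity)).trans (le_of_eq ?_)
    rw [h8, hlam, div_pow, div_pow, one_pow]
    field_simp
  linarith

/-- Jensen's inequality: the entropy is at least `-log ∑ ν f²`. -/
lemma LazyWeights.sum_mul_log_le {V : Type*} (W : LazyWeights V) {f : V → ℝ} (hf : ∀ y, 0 ≤ f y)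
    (hfs : HasSum (fun y => W.ν y * f y) 1) (h2 : Summable fun y => W.ν y * f y ^ 2)
    (hl : Summable fun y => W.ν y * (f y * Real.log (f y))) :
    0 < ∑' y, W.ν y * f y ^ 2 ∧
      ∑' y, W.ν y * (f y * Real.log (f y)) ≤ Real.log (∑' y, W.ν y * f y ^ 2) := by
  have hnn : ∀ y, 0 ≤ W.ν y * f y ^ 2 := fun y => mul_nonneg (W.pos y).le (sq_nonneg _)
  have hu : 0 < ∑' y, W.ν y * f y ^ 2 := by
    obtain ⟨y, hy⟩ : ∃ y, f y ≠ 0 := by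
      by_contra! h
      simp only [h, mul_zero] at hfs
      exact zero_ne_one (hasSum_zero.unique hfs)
    exact h2.tsum_pos hnn y (mul_pos (W.pos y) (by positivity))
  refine ⟨hu, ?_⟩
  set u := ∑' y, W.ν y * f y ^ 2 with hudef
  have h3 := hasSum_le (fun y => ?_) hl.hasSum
    ((h2.hasSum.mul_left (1 / u)).add (hfs.mul_left (Real.log u - 1)))
  · rw [← hudef] at h3
    have : 1 / u * u = 1 := by field_simp
    linarith
  · rcases (hf y).eq_or_lt with h | h
    · simp [← h]
    · have h4 := Real.log_le_sub_one_of_pos (div_pos h hu)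
      rw [Real.log_div h.ne' hu.ne'] at h4
      have h5 := mul_le_mul_of_nonneg_left h4 (mul_pos (W.pos y) h).le
      have h6 : W.ν y * f y * (f y / u - 1) = 1 / u * (W.ν y * f y ^ 2) - W.ν y * f y := by
        field_simp
      linarith

end Entropy

/-! ### Heat kernel and moment bounds for the lazy chain -/

namespace Conductances

variable {d : ℕ} (K : Conductances d)

open Classical in
/-- The edge weights of the lazy version of the chain, which at each step stays put with probability
`1 / 2` and otherwise jumps according to the conductances. -/
noncomputable def lazyWeights : LazyWeights (IntLattice d) where
  w y z := ((K.C y z : ℝ) + if z = y then (K.nu y : ℝ) else 0) / 2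
  ν y := K.nu y
  nonneg y z := by split_ifs <;> positivity
  symm y z := by
    rw [K.symm y z]
    rcases eq_or_ne z y with rfl | h
    · rfl
    · simp [h, h.symm]
  hasSum y := by
    have h1 : HasSum (fun z => (K.C y z : ℝ)) (K.nu y) :=
      NNReal.hasSum_coe.2 (K.summable y).hasSum
    have h2 := (h1.add (hasSum_ite_eq y (K.nu y : ℝ))).div_const 2
    rwa [add_self_div_two] at h2
  pos y := NNReal.coe_pos.2 (K.pos y)
  lazy y := by simp [K.diag]; linarith

lemma lazyWeights_w (y z : IntLattice d) (h : z ≠ y) :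
    K.lazyWeights.w y z = (K.C y z : ℝ) / 2 := by
  simp [lazyWeights, h]

lemma half_C_le (y z : IntLattice d) : (K.C y z : ℝ) / 2 ≤ K.lazyWeights.w y z := by
  simp only [lazyWeights]
  split_ifs
  · have : (0 : ℝ) ≤ K.nu y := NNReal.coe_nonneg _
    linarith
  · simp

/-- The density with respect to `ν` of the lazy chain started at `x`, at time `m`. -/
noncomputable def dens (x : IntLattice d) : ℕ → IntLattice d → ℝ
  | 0 => Pi.single x (1 / K.nu x)
  | m + 1 => K.lazyWeights.avg (dens x m)

lemma dens_nonneg (x : IntLattice d) (m : ℕ) (y : IntLattice d) : 0 ≤ K.dens x m y := by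
  induction m generalizing y with
  | zero =>
    rcases eq_or_ne y x with rfl | h
    · simp [dens]
    · simp [dens, h]
  | succ m ih => exact K.lazyWeights.avg_nonneg ih y

lemma hasSum_dens (x : IntLattice d) (m : ℕ) :
    HasSum (fun y => K.lazyWeights.ν y * K.dens x m y) 1 := by
  induction m with
  | zero =>
    have h := hasSum_single (f := fun y => K.lazyWeights.ν y * K.dens x 0 y) x fun y hy => by
      simp [dens, hy]
    have h2 : K.lazyWeights.ν x * K.dens x 0 x = 1 := by
      have : (K.nu x : ℝ) ≠ 0 := (K.lazyWeights.pos x).ne'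
      simp [dens, lazyWeights, this]
    rwa [h2] at h
  | succ m ih =>
    have := K.lazyWeights.hasSum_avg ih.summable
    rwa [ih.tsum_eq] at this

variable {K}

lemma A1.le_nu {c₁ c₂ : ℝ} (h : K.A1 c₁ c₂) (y : IntLattice d) : c₁ ≤ K.lazyWeights.ν y :=
  (h.2.2 y).1

lemma A1.nu_le {c₁ c₂ : ℝ} (h : K.A1 c₁ c₂) (y : IntLattice d) : K.lazyWeights.ν y ≤ c₂ :=
  (h.2.2 y).2

lemma A1.summable_dens {c₁ c₂ : ℝ} (h : K.A1 c₁ c₂) (x : IntLattice d) (m : ℕ) :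
    Summable (K.dens x m) ∧ ∑' y, K.dens x m y ≤ 1 / c₁ := by
  have hm := K.hasSum_dens x m
  have hpt : ∀ y, K.dens x m y ≤ 1 / c₁ * (K.lazyWeights.ν y * K.dens x m y) := fun y => by
    rw [one_div, inv_mul_eq_div, le_div_iff₀ h.1, mul_comm]
    exact mul_le_mul_of_nonneg_right (h.le_nu y) (K.dens_nonneg x m y)
  have hs := Summable.of_nonneg_of_le (K.dens_nonneg x m) hpt (hm.summable.mul_left _)
  refine ⟨hs, (hs.tsum_le_tsum hpt (hm.summable.mul_left _)).trans ?_⟩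
  rw [tsum_mul_left, hm.tsum_eq, mul_one]

lemma A1.summable_sq_dens {c₁ c₂ : ℝ} (h : K.A1 c₁ c₂) (x : IntLattice d) (m : ℕ) :
    Summable fun y => K.lazyWeights.ν y * K.dens x m y ^ 2 :=
  Summable.of_nonneg_of_le (fun y => mul_nonneg (K.lazyWeights.pos y).le (sq_nonneg _))
    (fun y => mul_le_mul_of_nonneg_right (h.nu_le y) (sq_nonneg _))
    ((summable_sq_of_summable (K.dens_nonneg x m) (h.summable_dens x m).1).mul_left c₂)

/-- On-diagonal heat kernel bound: `∑ ν p_m² ≤ R m^{-d/2}`, uniformly in the conductances. -/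
lemma exists_sq_dens_bound (d : ℕ) {c₁ c₂ : ℝ} (hc₁ : 0 < c₁) (hc₂ : 0 < c₂) (M₀ : ℝ) {δ : ℝ}
    (hδ : 0 < δ) : ∃ R : ℝ, 0 < R ∧ ∀ K : Conductances d, K.A1 c₁ c₂ → K.A2 M₀ δ →
      ∀ x (m : ℕ), (∑' y, K.lazyWeights.ν y * K.dens x m y ^ 2) * √m ^ d ≤ R := by
  set β : ℝ := (((2 * ⌈M₀⌉₊ + 1) ^ d : ℕ) : ℝ) ^ 3 / δ with hβ
  have hβ0 : 0 ≤ β := by positivity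
  obtain ⟨R, hR, H⟩ := exists_decay_bound d (K₁ := c₂ * (d : ℝ) ^ 2 * β * 12)
    (K₂ := 2 * c₂ / c₁ ^ 2) (U := 1 / c₁) (by positivity) (by positivity)
  refine ⟨R, hR, fun K h1 h2 x => ?_⟩
  have h2s := h1.summable_sq_dens x
  have hdis := fun m => K.lazyWeights.dirichlet_le (K.dens_nonneg x m) (K.hasSum_dens x m).summable
    (h2s m) (h2s (m + 1))
  refine H (fun m => ∑' y, K.lazyWeights.ν y * K.dens x m y ^ 2) (fun m => tsum_nonneg fun y =>
    mul_nonneg (K.lazyWeights.pos y).le (sq_nonneg _)) (fun m => ?_) (fun m => ?_) fun m n hn => ?_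
  · have h3 := (hdis m).2
    have h4 : 0 ≤ ∑' p : IntLattice d × IntLattice d,
        K.lazyWeights.w p.1 p.2 * (K.dens x m p.2 - K.dens x m p.1) ^ 2 :=
      tsum_nonneg fun p => mul_nonneg (K.lazyWeights.nonneg _ _) (sq_nonneg _)
    show ∑' y, K.lazyWeights.ν y * K.lazyWeights.avg (K.dens x m) y ^ 2 ≤ _
    linarith
  · have hm := K.hasSum_dens x m
    have := (h2s m).tsum_le_tsum (fun y => by
      show _ ≤ 1 / c₁ * (K.lazyWeights.ν y * K.dens x m y)
      have h3 := K.lazyWeights.apply_le_inv hc₁ h1.le_nu (K.dens_nonneg x m) hm y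
      have h4 := mul_le_mul_of_nonneg_right h3
        (mul_nonneg (K.lazyWeights.pos y).le (K.dens_nonneg x m y))
      linarith) (hm.summable.mul_left (1 / c₁))
    rwa [tsum_mul_left, hm.tsum_eq, mul_one] at this
  · obtain ⟨hs, hle⟩ := h1.summable_dens x m
    have hf0 := K.dens_nonneg x m
    have hsq := summable_sq_of_summable hf0 hs
    set f := K.dens x m with hf
    have hCw : ∀ p : IntLattice d × IntLattice d, (K.C p.1 p.2 : ℝ) * (f p.2 - f p.1) ^ 2 ≤
        2 * (K.lazyWeights.w p.1 p.2 * (f p.2 - f p.1) ^ 2) := fun p => by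
      have := mul_le_mul_of_nonneg_right (K.half_C_le p.1 p.2) (sq_nonneg (f p.2 - f p.1))
      linarith
    have hCs : Summable fun p : IntLattice d × IntLattice d =>
        (K.C p.1 p.2 : ℝ) * (f p.2 - f p.1) ^ 2 :=
      Summable.of_nonneg_of_le (fun p => by positivity) hCw ((hdis m).1.mul_left 2)
    have hCle := hCs.tsum_le_tsum hCw ((hdis m).1.mul_left 2)
    rw [tsum_mul_left] at hCle
    set E := ∑' p : IntLattice d × IntLattice d, (K.C p.1 p.2 : ℝ) * (f p.2 - f p.1) ^ 2
    have hE0 : 0 ≤ E := tsum_nonneg fun p => by positivity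
    have hnash := nash_inequality hf0 hs (E := β * E) (fun i => h2.nearest_neighbour_le hsq hCs i)
      (by positivity) hn
    have hN : (0 : ℝ) < (n : ℝ) ^ d := by positivity
    have hsum0 : 0 ≤ ∑' y, f y := tsum_nonneg hf0
    have h3 : 2 * (∑' y, f y) ^ 2 / (n : ℝ) ^ d ≤ 2 * (1 / c₁) ^ 2 / (n : ℝ) ^ d := by gcongr
    have h4 : ∑' y, K.lazyWeights.ν y * f y ^ 2 ≤ c₂ * ∑' y, f y ^ 2 := by
      rw [← tsum_mul_left]
      exact (h2s m).tsum_le_tsum (fun y => mul_le_mul_of_nonneg_right (h1.nu_le y) (sq_nonneg _))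
        (hsq.mul_left c₂)
    have h5 : E ≤ 12 * (∑' y, K.lazyWeights.ν y * f y ^ 2 -
        ∑' y, K.lazyWeights.ν y * K.dens x (m + 1) y ^ 2) := by
      have h6 := (hdis m).2
      show E ≤ 12 * (_ - ∑' y, K.lazyWeights.ν y * K.lazyWeights.avg f y ^ 2)
      linarith
    set G := ∑' y, K.lazyWeights.ν y * f y ^ 2 -
        ∑' y, K.lazyWeights.ν y * K.dens x (m + 1) y ^ 2
    calc ∑' y, K.lazyWeights.ν y * f y ^ 2 ≤ c₂ * ∑' y, f y ^ 2 := h4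
      _ ≤ c₂ * (((d : ℝ) * n) ^ 2 * (β * (12 * G)) + 2 * (1 / c₁) ^ 2 / (n : ℝ) ^ d) := by
        refine mul_le_mul_of_nonneg_left (hnash.trans (add_le_add ?_ h3)) hc₂.le
        gcongr
      _ = _ := by
        field_simp

lemma A3.lazy_second_moment {φ : ℕ → ℝ} (h : K.A3 φ) {c₁ c₂ : ℝ} (h1 : K.A1 c₁ c₂)
    (y : IntLattice d) :
    Summable (fun z => K.lazyWeights.w y z * l1Norm (y - z) ^ 2) ∧
      ∑' z, K.lazyWeights.w y z * l1Norm (y - z) ^ 2 ≤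
        |(d : ℝ) ^ 2 * (2 * d * 3 ^ d * ∑' i : ℕ, (i : ℝ) ^ (d + 1) * φ i)| / c₁ *
          K.lazyWeights.ν y := by
  obtain ⟨hs, hle⟩ := h.second_moment y
  set Z := (d : ℝ) ^ 2 * (2 * d * 3 ^ d * ∑' i : ℕ, (i : ℝ) ^ (d + 1) * φ i)
  have heq : ∀ z, K.lazyWeights.w y z * l1Norm (y - z) ^ 2 =
      1 / 2 * ((K.C y z : ℝ) * l1Norm (y - z) ^ 2) := fun z => by
    rcases eq_or_ne z y with rfl | hz
    · have : l1Norm (z - z) = 0 := by simp [l1Norm]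
      rw [this]; simp
    · rw [K.lazyWeights_w y z hz]; ring
  simp only [heq, tsum_mul_left]
  refine ⟨hs.mul_left _, ?_⟩
  have h2 : |Z| ≤ |Z| / c₁ * K.lazyWeights.ν y := by
    rw [div_mul_eq_mul_div, le_div_iff₀ h1.1]
    exact mul_le_mul_of_nonneg_left (h1.le_nu y) (abs_nonneg Z)
  have := le_abs_self Z
  have := abs_nonneg Z
  linarith

/-- Diffusive bound on the first moment of the lazy chain, uniform in the starting point and in the
conductances. -/
theorem exists_moment_dens_bound (d : ℕ) {c₁ c₂ : ℝ} (hc₁ : 0 < c₁) (hc₂ : 0 < c₂) (M₀ : ℝ) {δ : ℝ}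
    (hδ : 0 < δ) (φ : ℕ → ℝ) :
    ∃ S : ℝ, 0 < S ∧ ∀ K : Conductances d, K.A1 c₁ c₂ → K.A2 M₀ δ → K.A3 φ → ∀ x (m : ℕ),
      Summable (fun y => K.lazyWeights.ν y * (K.dens x m y * l1Norm (x - y))) ∧
        ∑' y, K.lazyWeights.ν y * (K.dens x m y * l1Norm (x - y)) ≤ S * √m := by
  obtain ⟨R, hR, hu⟩ := exists_sq_dens_bound d hc₁ hc₂ M₀ hδ
  set b := |(d : ℝ) ^ 2 * (2 * d * 3 ^ d * ∑' i : ℕ, (i : ℝ) ^ (d + 1) * φ i)| / c₁ with hb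
  have hb0 : 0 ≤ b := by positivity
  obtain ⟨S, hS, H⟩ := exists_moment_bound d (a := 1 + b) (b := b) (c := 1 + c₂ * 4 ^ d)
    (R := Real.log R) (by positivity) hb0
  refine ⟨S, hS, fun K h1 h2 h3 x => ?_⟩
  have hd₀ : ∀ y : IntLattice d, 0 ≤ l1Norm (x - y) := fun y => l1Norm_nonneg _
  have hd : ∀ y z : IntLattice d, |l1Norm (x - y) - l1Norm (x - z)| ≤ l1Norm (y - z) := by
    have h4 : ∀ y z : IntLattice d, l1Norm (x - y) ≤ l1Norm (x - z) + l1Norm (y - z) :=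
      fun y z => by
        rw [l1Norm_sub_comm y z, ← sub_add_sub_cancel x z y]
        exact l1Norm_add_le _ _
    intro y z
    have := h4 y z
    have := h4 z y
    rw [l1Norm_sub_comm z y] at this
    rw [abs_le]
    constructor <;> linarith
  have hρ := fun y => (h3.lazy_second_moment h1 y).1
  have hM := fun y => (h3.lazy_second_moment h1 y).2
  have hfd : ∀ m, Summable fun y => K.lazyWeights.ν y * (K.dens x m y * l1Norm (x - y)) := by
    intro m
    induction m with
    | zero =>
      refine summable_of_hasFiniteSupport ((Set.finite_singleton x).subset fun y hy => ?_)
      by_contra hne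
      exact hy (by simp [dens, show y ≠ x from hne])
    | succ m ih => exact (K.lazyWeights.hasSum_moment_increment hd₀ hd hρ hM (K.dens_nonneg x m)
        (K.hasSum_dens x m).summable ih).1
  have hlog := fun m => K.lazyWeights.summable_mul_log hc₁ h1.le_nu h1.nu_le (K.dens_nonneg x m)
    (K.hasSum_dens x m) (hfd m)
  set M : ℕ → ℝ := fun m => ∑' y, K.lazyWeights.ν y * (K.dens x m y * l1Norm (x - y)) with hMdef
  have hM0 : M 0 = 0 := by
    have : ∀ y, K.lazyWeights.ν y * (K.dens x 0 y * l1Norm (x - y)) = 0 := fun y => by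
      rcases eq_or_ne y x with rfl | hy
      · simp [l1Norm]
      · simp [dens, hy]
    simp only [hMdef, this, tsum_zero]
  have key := H M (fun m => -∑' y, K.lazyWeights.ν y * (K.dens x m y * Real.log (K.dens x m y)))
    (fun m => tsum_nonneg fun y => mul_nonneg (K.lazyWeights.pos y).le
      (mul_nonneg (K.dens_nonneg x m y) (hd₀ y))) hM0
    (fun m => K.lazyWeights.moment_le_add hd₀ hd hρ hM (K.dens_nonneg x m) (K.hasSum_dens x m)
      (hfd m))
    (fun m ε hε => ?_)
    (fun m => K.lazyWeights.entropy_le hc₁ h1.le_nu h1.nu_le (K.dens_nonneg x m)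
      (K.hasSum_dens x m) (hfd m)) (fun m hm => ?_)
  · intro m
    refine ⟨hfd m, ?_⟩
    rcases Nat.eq_zero_or_pos m with rfl | hm
    · show M 0 ≤ _
      rw [hM0]; simp
    · have := key m hm
      show M m ≤ _
      linarith
  · have := K.lazyWeights.moment_le_entropy hd₀ hd (fun y z => l1Norm_sub_comm y z) hρ hM
      (K.dens_nonneg x m) (K.hasSum_dens x m) (hfd m) (hlog m) (hlog (m + 1)) hε
    rw [neg_sub_neg]
    exact this
  · have h4 := K.lazyWeights.sum_mul_log_le (K.dens_nonneg x m) (K.hasSum_dens x m)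
      (h1.summable_sq_dens x m) (hlog m)
    have hm0 : (0 : ℝ) < √m := Real.sqrt_pos.2 (by exact_mod_cast hm)
    have h5 := Real.log_le_log (mul_pos h4.1 (pow_pos hm0 d)) (hu K h1 h2 x m)
    rw [Real.log_mul h4.1.ne' (pow_pos hm0 d).ne', Real.log_pow] at h5
    linarith [h4.2]

end Conductances

/-! ### The Markov property and the maximal inequality -/

namespace Conductances

variable {d : ℕ} (K : Conductances d)

/-- The trajectories which stay in `S` at all times `k < n`. -/
def staysIn (S : Set (IntLattice d)) (n : ℕ) : Set (ℕ → IntLattice d) := {X | ∀ k < n, X k ∈ S}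

lemma measurableSet_staysIn (S : Set (IntLattice d)) (n : ℕ) : MeasurableSet (staysIn S n) := by
  have : staysIn S n = ⋂ k ∈ Set.Iio n, (fun X : ℕ → IntLattice d => X k) ⁻¹' S := by
    ext X; simp [staysIn]
  rw [this]
  exact MeasurableSet.biInter (Set.to_countable _) fun k _ =>
    measurable_pi_apply k (S.to_countable.measurableSet)

lemma lintegral_stepKernel (g : IntLattice d → ℝ≥0∞) (x : IntLattice d) :
    ∫⁻ z, g z ∂K.stepKernel x = (∑' z, (K.C x z : ℝ≥0∞) * g z) / K.nu x := by
  have : K.stepKernel x = (K.step x).toMeasure := rfl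
  rw [this, lintegral_countable', ENNReal.div_eq_inv_mul, ← ENNReal.tsum_mul_left]
  refine tsum_congr fun z => ?_
  rw [PMF.toMeasure_apply_singleton _ _ (measurableSet_singleton z), step, PMF.normalize_apply,
    K.tsum_coe_eq]
  ring

lemma chainLaw_zero (x : IntLattice d) : ∀ᵐ X ∂K.chainLaw x, X 0 = x := by
  have hmeas : MeasurableSet {X : ℕ → IntLattice d | X 0 = x} :=
    (measurable_pi_apply (X := fun _ => IntLattice d) 0) (measurableSet_singleton x)
  have h := Kernel.traj_map_updateFinset (X := fun _ => IntLattice d) (κ := K.histKernel)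
    (fun _ : Finset.Iic 0 => x)
  rw [chainLaw, ← h]
  rw [ae_map_iff (by fun_prop) hmeas]
  filter_upwards with X
  simp [Function.updateFinset]

/-- The Markov property at a fixed time. -/
lemma setLIntegral_staysIn_succ (x : IntLattice d) (S : Set (IntLattice d)) (n : ℕ)
    (g : IntLattice d → ℝ≥0∞) :
    ∫⁻ X in staysIn S (n + 1), g (X (n + 1)) ∂K.chainLaw x =
      ∫⁻ X in staysIn S (n + 1), ∫⁻ z, g z ∂K.stepKernel (X n) ∂K.chainLaw x := by
  set A : Set (∀ _ : Finset.Iic n, IntLattice d) := {h | ∀ k, h k ∈ S} with hA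
  have hg : Measurable g := (measurable_of_countable _)
  have hAm : MeasurableSet A := A.to_countable.measurableSet
  let past : (ℕ → IntLattice d) → (∀ _ : Finset.Iic n, IntLattice d) := Preorder.frestrictLe n
  have hpast : Measurable past := Preorder.measurable_frestrictLe (X := fun _ => IntLattice d) n
  have hSA : ∀ X : ℕ → IntLattice d, X ∈ staysIn S (n + 1) ↔ past X ∈ A := by
    intro X
    simp only [past, staysIn, hA, Set.mem_ofPred_eq, Preorder.frestrictLe_apply, Subtype.forall,
      Finset.mem_Iic, Nat.lt_succ_iff]
  have h : (K.chainLaw x).map past ⊗ₘ K.histKernel n =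
      (K.chainLaw x).map fun X => (past X, X (n + 1)) := by
    have h := Kernel.partialTraj_compProd_eq_map_traj (X := fun _ => IntLattice d)
      (κ := K.histKernel) (Nat.zero_le n) (x₀ := fun _ => x)
    rwa [← Kernel.traj_map_frestrictLe_apply] at h
  have hG : Measurable fun p : (∀ _ : Finset.Iic n, IntLattice d) × IntLattice d =>
      A.indicator (fun _ => g p.2) p.1 := measurable_from_prod_countable_right fun _ =>
        measurable_of_countable _
  rw [← lintegral_indicator (measurableSet_staysIn _ _),
    ← lintegral_indicator (measurableSet_staysIn _ _)]
  calc ∫⁻ X, (staysIn S (n + 1)).indicator (fun X => g (X (n + 1))) X ∂K.chainLaw x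
      = ∫⁻ X, (fun p : (∀ _ : Finset.Iic n, IntLattice d) × IntLattice d =>
          A.indicator (fun _ => g p.2) p.1) (past X, X (n + 1)) ∂K.chainLaw x := by
        refine lintegral_congr fun X => ?_
        by_cases hX : X ∈ staysIn S (n + 1)
        · rw [Set.indicator_of_mem hX]
          dsimp only
          rw [Set.indicator_of_mem ((hSA X).1 hX)]
        · rw [Set.indicator_of_notMem hX]
          dsimp only
          rw [Set.indicator_of_notMem (fun h => hX ((hSA X).2 h))]
    _ = ∫⁻ u, ∫⁻ z, A.indicator (fun _ => g z) u ∂K.histKernel n u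
          ∂(K.chainLaw x).map past := by
        rw [← lintegral_map (g := fun X : ℕ → IntLattice d => (past X, X (n + 1))) hG
          (hpast.prodMk (measurable_pi_apply (n + 1))), ← h, Measure.lintegral_compProd hG]
    _ = ∫⁻ X, ∫⁻ z, A.indicator (fun _ => g z) (past X)
          ∂K.histKernel n (past X) ∂K.chainLaw x := by
        rw [lintegral_map (measurable_of_countable _) hpast]
    _ = _ := by
        refine lintegral_congr fun X => ?_
        by_cases hX : X ∈ staysIn S (n + 1)
        · rw [Set.indicator_of_mem hX]
          simp only [Set.indicator_of_mem ((hSA X).1 hX)]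
          rfl
        · rw [Set.indicator_of_notMem hX]
          simp only [Set.indicator_of_notMem (fun h => hX ((hSA X).2 h)), lintegral_zero]

/-- Maximal inequality: if `μ ^ k * h (X k)` is a supermartingale and `h ≥ a` outside `S`, then
leaving `S` before time `n` has probability at most `h x / (a μ ^ n)`. -/
lemma pow_mul_exit_le {h : IntLattice d → ℝ≥0∞} {μ a : ℝ≥0∞} {S : Set (IntLattice d)} (hμ : μ ≤ 1)
    (hsup : ∀ w, μ * ∫⁻ z, h z ∂K.stepKernel w ≤ h w) (ha : ∀ w ∉ S, a ≤ h w)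
    (x : IntLattice d) (n : ℕ) :
    μ ^ n * (a * K.chainLaw x (staysIn S n)ᶜ) ≤ h x := by
  suffices H : μ ^ n * (a * K.chainLaw x (staysIn S n)ᶜ +
      ∫⁻ X in staysIn S n, h (X n) ∂K.chainLaw x) ≤ h x from
    (mul_le_mul_right le_self_add _).trans H
  induction n with
  | zero =>
    have h0 : staysIn S 0 = Set.univ := by ext; simp [staysIn]
    rw [h0, Set.compl_univ, measure_empty, mul_zero, zero_add, pow_zero, one_mul,
      Measure.restrict_univ, lintegral_congr_ae ((K.chainLaw_zero x).mono fun X hX => by rw [hX])]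
    simp
  | succ n ih =>
    refine le_trans ?_ ih
    set F := staysIn S n \ staysIn S (n + 1) with hF
    have hsub : staysIn S (n + 1) ⊆ staysIn S n := fun X hX k hk => hX k (by omega)
    have hFm : MeasurableSet F := (measurableSet_staysIn S n).diff (measurableSet_staysIn S _)
    have hFS : ∀ X ∈ F, X n ∉ S := by
      rintro X ⟨h1, h2⟩ h3
      refine h2 fun k hk => ?_
      rcases Nat.lt_succ_iff_lt_or_eq.1 hk with h | rfl
      · exact h1 k h
      · exact h3
    have hc : (staysIn S (n + 1))ᶜ = (staysIn S n)ᶜ ∪ F := by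
      ext X
      have := @hsub X
      simp only [hF, Set.mem_compl_iff, Set.mem_union, Set.mem_sdiff]
      tauto
    have h1 : K.chainLaw x (staysIn S (n + 1))ᶜ ≤
        K.chainLaw x (staysIn S n)ᶜ + K.chainLaw x F := by
      rw [hc]; exact measure_union_le _ _
    have h2 : ∫⁻ X in staysIn S n, h (X n) ∂K.chainLaw x =
        ∫⁻ X in staysIn S (n + 1), h (X n) ∂K.chainLaw x + ∫⁻ X in F, h (X n) ∂K.chainLaw x := by
      rw [← lintegral_union hFm Set.disjoint_sdiff_right, hF, Set.union_sdiff_cancel hsub]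
    have h3 : a * K.chainLaw x F ≤ ∫⁻ X in F, h (X n) ∂K.chainLaw x := by
      rw [← setLIntegral_const]
      exact setLIntegral_mono' hFm fun X hX => ha _ (hFS X hX)
    have h4 : μ * ∫⁻ X in staysIn S (n + 1), h (X (n + 1)) ∂K.chainLaw x ≤
        ∫⁻ X in staysIn S (n + 1), h (X n) ∂K.chainLaw x := by
      rw [K.setLIntegral_staysIn_succ]
      exact (lintegral_const_mul_le _ _).trans (lintegral_mono fun X => hsup _)
    rw [pow_succ, mul_assoc]
    refine mul_le_mul_right ?_ _
    calc μ * (a * K.chainLaw x (staysIn S (n + 1))ᶜ +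
          ∫⁻ X in staysIn S (n + 1), h (X (n + 1)) ∂K.chainLaw x)
        ≤ 1 * (a * K.chainLaw x (staysIn S (n + 1))ᶜ) +
          μ * ∫⁻ X in staysIn S (n + 1), h (X (n + 1)) ∂K.chainLaw x := by
          rw [mul_add]; gcongr
      _ ≤ a * (K.chainLaw x (staysIn S n)ᶜ + K.chainLaw x F) +
          ∫⁻ X in staysIn S (n + 1), h (X n) ∂K.chainLaw x := by
          rw [one_mul]; gcongr
      _ ≤ a * K.chainLaw x (staysIn S n)ᶜ + (∫⁻ X in F, h (X n) ∂K.chainLaw x +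
          ∫⁻ X in staysIn S (n + 1), h (X n) ∂K.chainLaw x) := by
          rw [mul_add, add_assoc]; gcongr
      _ = _ := by rw [h2, add_comm (∫⁻ X in F, h (X n) ∂K.chainLaw x)]

end Conductances

/-! ### From the moment bound to exit probabilities -/

namespace Conductances

variable {d : ℕ} (K : Conductances d)

lemma tsum_lazyWeights_mul (g : IntLattice d → ℝ≥0∞) (x : IntLattice d) :
    ∑' z, ENNReal.ofReal (K.lazyWeights.w x z) * g z =
      2⁻¹ * (∑' z, (K.C x z : ℝ≥0∞) * g z + K.nu x * g x) := by
  classical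
  have h : ∀ z, ENNReal.ofReal (K.lazyWeights.w x z) * g z =
      2⁻¹ * ((K.C x z : ℝ≥0∞) * g z + if z = x then (K.nu x : ℝ≥0∞) * g x else 0) := fun z => by
    have h1 : K.lazyWeights.w x z =
        ((2⁻¹ * (K.C x z + if z = x then K.nu x else 0) : ℝ≥0) : ℝ) := by
      simp only [lazyWeights]
      split_ifs <;> push_cast <;> ring
    rw [h1, ENNReal.ofReal_coe_nnreal, ENNReal.coe_mul, ENNReal.coe_add,
      ENNReal.coe_inv two_ne_zero, ENNReal.coe_ofNat, mul_assoc]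
    congr 1
    split_ifs with hz
    · rw [add_mul, hz]
    · simp
  simp only [h, ENNReal.tsum_mul_left, ENNReal.tsum_add, tsum_ite_eq]

lemma nu_mul_ofReal_dens_succ (x y : IntLattice d) (m : ℕ) :
    (K.nu y : ℝ≥0∞) * ENNReal.ofReal (K.dens x (m + 1) y) =
      ∑' z, ENNReal.ofReal (K.lazyWeights.w y z) * ENNReal.ofReal (K.dens x m z) := by
  have h1 : K.lazyWeights.ν y * K.dens x (m + 1) y = ∑' z, K.lazyWeights.w y z * K.dens x m z :=
    K.lazyWeights.ν_mul_avg _ y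
  rw [← ENNReal.ofReal_coe_nnreal, ← ENNReal.ofReal_mul (NNReal.coe_nonneg _)]
  change ENNReal.ofReal (K.lazyWeights.ν y * K.dens x (m + 1) y) = _
  rw [h1, ENNReal.ofReal_tsum_of_nonneg
    (fun z => mul_nonneg (K.lazyWeights.nonneg y z) (K.dens_nonneg x m z))
    (K.lazyWeights.summable_row (K.hasSum_dens x m).summable y)]
  exact tsum_congr fun z => ENNReal.ofReal_mul (K.lazyWeights.nonneg y z)

/-- The backward equation: `dens` evolves by the first step of the chain, too. -/
lemma nu_mul_ofReal_dens_succ' (x y : IntLattice d) (m : ℕ) :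
    (K.nu x : ℝ≥0∞) * ENNReal.ofReal (K.dens x (m + 1) y) =
      ∑' z, ENNReal.ofReal (K.lazyWeights.w x z) * ENNReal.ofReal (K.dens z m y) := by
  have hne : ∀ v, (K.nu v : ℝ≥0∞) ≠ 0 := fun v => ENNReal.coe_ne_zero.2 (K.pos v).ne'
  have hnt : ∀ v, (K.nu v : ℝ≥0∞) ≠ ⊤ := fun v => ENNReal.coe_ne_top
  induction m generalizing y with
  | zero =>
    have h0 : ∀ x z, ENNReal.ofReal (K.dens x 0 z) = if z = x then (K.nu x : ℝ≥0∞)⁻¹ else 0 :=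
      fun x z => by
        by_cases h : z = x
        · subst h
          rw [if_pos rfl, dens, Pi.single_eq_same, one_div, ENNReal.ofReal_inv_of_pos
            (show (0 : ℝ) < K.nu z from K.lazyWeights.pos z), ENNReal.ofReal_coe_nnreal]
        · rw [if_neg h, dens, Pi.single_eq_of_ne h, ENNReal.ofReal_zero]
    rw [← ENNReal.mul_right_inj (hne y) (hnt y), mul_left_comm, nu_mul_ofReal_dens_succ]
    have h1 : ∑' z, ENNReal.ofReal (K.lazyWeights.w y z) * ENNReal.ofReal (K.dens x 0 z) =
        ENNReal.ofReal (K.lazyWeights.w y x) * (K.nu x : ℝ≥0∞)⁻¹ := by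
      rw [tsum_eq_single x fun z hz => by rw [h0, if_neg hz, mul_zero], h0, if_pos rfl]
    have h2 : ∑' z, ENNReal.ofReal (K.lazyWeights.w x z) * ENNReal.ofReal (K.dens z 0 y) =
        ENNReal.ofReal (K.lazyWeights.w x y) * (K.nu y : ℝ≥0∞)⁻¹ := by
      rw [tsum_eq_single y fun z hz => by rw [h0, if_neg hz.symm, mul_zero], h0, if_pos rfl]
    rw [h1, h2, K.lazyWeights.symm x y, mul_left_comm, mul_left_comm (K.nu y : ℝ≥0∞),
      ENNReal.mul_inv_cancel (hne x) (hnt x), ENNReal.mul_inv_cancel (hne y) (hnt y)]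
  | succ m ih =>
    rw [← ENNReal.mul_right_inj (hne y) (hnt y), mul_left_comm, nu_mul_ofReal_dens_succ,
      ← ENNReal.tsum_mul_left, ← ENNReal.tsum_mul_left]
    calc ∑' z, (K.nu x : ℝ≥0∞) * (ENNReal.ofReal (K.lazyWeights.w y z) *
          ENNReal.ofReal (K.dens x (m + 1) z))
        = ∑' z, ∑' v, ENNReal.ofReal (K.lazyWeights.w y z) *
            (ENNReal.ofReal (K.lazyWeights.w x v) * ENNReal.ofReal (K.dens v m z)) := by
          refine tsum_congr fun z => ?_
          rw [mul_left_comm, ih, ENNReal.tsum_mul_left]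
      _ = ∑' v, ∑' z, ENNReal.ofReal (K.lazyWeights.w y z) *
            (ENNReal.ofReal (K.lazyWeights.w x v) * ENNReal.ofReal (K.dens v m z)) :=
          ENNReal.tsum_comm
      _ = _ := by
          refine tsum_congr fun v => ?_
          simp only [mul_left_comm _ (ENNReal.ofReal (K.lazyWeights.w x v))]
          rw [ENNReal.tsum_mul_left, ← nu_mul_ofReal_dens_succ, mul_left_comm]

/-- The probability that the lazy chain started at `x` is in `F` at time `m`. -/
noncomputable def lazyProb (F : Set (IntLattice d)) (m : ℕ) (x : IntLattice d) : ℝ≥0∞ :=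
  ∑' y, F.indicator (fun y => (K.nu y : ℝ≥0∞) * ENNReal.ofReal (K.dens x m y)) y

lemma lazyProb_univ (m : ℕ) (x : IntLattice d) : K.lazyProb Set.univ m x = 1 := by
  have h := K.hasSum_dens x m
  simp only [lazyProb, Set.indicator_univ]
  rw [← ENNReal.ofReal_one, ← h.tsum_eq, ENNReal.ofReal_tsum_of_nonneg (fun y =>
    mul_nonneg (K.lazyWeights.pos y).le (K.dens_nonneg x m y)) h.summable]
  refine tsum_congr fun y => ?_
  rw [ENNReal.ofReal_mul (K.lazyWeights.pos y).le, ← ENNReal.ofReal_coe_nnreal]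
  rfl

lemma lazyProb_add_compl (F : Set (IntLattice d)) (m : ℕ) (x : IntLattice d) :
    K.lazyProb F m x + K.lazyProb Fᶜ m x = 1 := by
  rw [← K.lazyProb_univ m x, lazyProb, lazyProb, ← ENNReal.tsum_add, lazyProb, Set.indicator_univ]
  exact tsum_congr fun y => congrFun (Set.indicator_self_add_compl F _) y

lemma nu_mul_lazyProb_succ (F : Set (IntLattice d)) (m : ℕ) (x : IntLattice d) :
    (K.nu x : ℝ≥0∞) * K.lazyProb F (m + 1) x =
      ∑' z, ENNReal.ofReal (K.lazyWeights.w x z) * K.lazyProb F m z := by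
  simp only [lazyProb, ← ENNReal.tsum_mul_left]
  rw [ENNReal.tsum_comm]
  refine tsum_congr fun y => ?_
  by_cases hy : y ∈ F
  · simp only [Set.indicator_of_mem hy]
    rw [mul_left_comm, nu_mul_ofReal_dens_succ', ← ENNReal.tsum_mul_left]
    exact tsum_congr fun z => mul_left_comm _ _ _
  · simp [Set.indicator_of_notMem hy]

/-- The probability that the lazy chain started at `x` is in `F` at an independent geometric time
`ξ`, with `ℙ(ξ = m) = (1 - lam) lam ^ m`. -/
noncomputable def geomProb (lam : ℝ) (F : Set (IntLattice d)) (x : IntLattice d) : ℝ≥0∞ :=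
  ∑' m : ℕ, ENNReal.ofReal ((1 - lam) * lam ^ m) * K.lazyProb F m x

variable {lam : ℝ}

lemma tsum_geom (h0 : 0 ≤ lam) (h1 : lam < 1) :
    ∑' m : ℕ, ENNReal.ofReal ((1 - lam) * lam ^ m) = 1 := by
  rw [← ENNReal.ofReal_tsum_of_nonneg
    (fun m => mul_nonneg (by linarith) (pow_nonneg h0 m))
    ((summable_geometric_of_lt_one h0 h1).mul_left _), tsum_mul_left,
    tsum_geometric_of_lt_one h0 h1, mul_inv_cancel₀ (by linarith), ENNReal.ofReal_one]

lemma geomProb_add_compl (h0 : 0 ≤ lam) (h1 : lam < 1) (F : Set (IntLattice d))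
    (x : IntLattice d) : K.geomProb lam F x + K.geomProb lam Fᶜ x = 1 := by
  rw [geomProb, geomProb, ← ENNReal.tsum_add, ← tsum_geom h0 h1]
  exact tsum_congr fun m => by rw [← mul_add, lazyProb_add_compl, mul_one]

/-- By the memoryless property of geometric times, `geomProb` is superharmonic for the chain killed
at rate `1 - lam / (2 - lam)`. -/
lemma geomProb_superharmonic (h0 : 0 < lam) (h1 : lam < 1) (F : Set (IntLattice d))
    (x : IntLattice d) :
    ENNReal.ofReal (lam / (2 - lam)) * ∫⁻ z, K.geomProb lam F z ∂K.stepKernel x ≤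
      K.geomProb lam F x := by
  have hne : (K.nu x : ℝ≥0∞) ≠ 0 := ENNReal.coe_ne_zero.2 (K.pos x).ne'
  have hnt : (K.nu x : ℝ≥0∞) ≠ ⊤ := ENNReal.coe_ne_top
  rw [lintegral_stepKernel]
  set P := (∑' z, (K.C x z : ℝ≥0∞) * K.geomProb lam F z) / K.nu x with hP
  set g := K.geomProb lam F x with hg
  have hle1 : g ≤ 1 := by
    rw [← K.geomProb_add_compl h0.le h1 F x]; exact le_self_add
  have hgt : g ≠ ⊤ := ne_top_of_le_ne_top ENNReal.one_ne_top hle1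
  have key : ENNReal.ofReal (lam / 2) * (P + g) ≤ g := by
    rw [← ENNReal.mul_le_mul_iff_right hne hnt]
    have h2 : (K.nu x : ℝ≥0∞) * (ENNReal.ofReal (lam / 2) * (P + g)) =
        ENNReal.ofReal lam * ∑' z, ENNReal.ofReal (K.lazyWeights.w x z) * K.geomProb lam F z := by
      rw [tsum_lazyWeights_mul, ENNReal.ofReal_div_of_pos two_pos, ENNReal.ofReal_ofNat,
        mul_left_comm, mul_add, hP, ENNReal.mul_div_cancel hne hnt, div_eq_mul_inv, mul_assoc]
    have h3 : ENNReal.ofReal lam * ∑' z, ENNReal.ofReal (K.lazyWeights.w x z) *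
        K.geomProb lam F z = ∑' m : ℕ, ENNReal.ofReal ((1 - lam) * lam ^ (m + 1)) *
          ((K.nu x : ℝ≥0∞) * K.lazyProb F (m + 1) x) := by
      simp only [geomProb, nu_mul_lazyProb_succ, ← ENNReal.tsum_mul_left]
      rw [ENNReal.tsum_comm]
      refine tsum_congr fun m => tsum_congr fun z => ?_
      rw [pow_succ, ← mul_assoc (1 - lam), ENNReal.ofReal_mul
        (mul_nonneg (by linarith) (pow_nonneg h0.le m))]
      ring
    rw [h2, h3, hg, geomProb, ← ENNReal.tsum_mul_left]
    simp only [mul_left_comm _ (K.nu x : ℝ≥0∞)]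
    exact ENNReal.tsum_comp_le_tsum_of_injective Nat.succ_injective
      (fun m : ℕ => (K.nu x : ℝ≥0∞) * (ENNReal.ofReal ((1 - lam) * lam ^ m) * K.lazyProb F m x))
  have hPt : P ≠ ⊤ := by
    intro h
    rw [h, top_add, ENNReal.mul_top (by simpa using h0)] at key
    exact hgt (top_le_iff.1 key)
  rw [← ENNReal.ofReal_toReal hPt, ← ENNReal.ofReal_toReal hgt] at key ⊢
  have hp0 : 0 ≤ P.toReal := ENNReal.toReal_nonneg
  have hg0 : 0 ≤ g.toReal := ENNReal.toReal_nonneg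
  rw [← ENNReal.ofReal_add hp0 hg0, ← ENNReal.ofReal_mul (by linarith),
    ENNReal.ofReal_le_ofReal_iff hg0] at key
  rw [← ENNReal.ofReal_mul (div_nonneg h0.le (by linarith))]
  refine ENNReal.ofReal_le_ofReal ?_
  rw [div_mul_eq_mul_div, div_le_iff₀ (by linarith)]
  linarith

variable {K} {S : ℝ}

/-- Chebyshev's inequality at a fixed time. -/
lemma lazyProb_le {x : IntLattice d} {m : ℕ}
    (hs : Summable (fun y => K.lazyWeights.ν y * (K.dens x m y * l1Norm (x - y))))
    (hS : ∑' y, K.lazyWeights.ν y * (K.dens x m y * l1Norm (x - y)) ≤ S * √m)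
    {G : Set (IntLattice d)} {ρ : ℝ} (hρ : 0 < ρ) (hG : ∀ y ∈ G, ρ ≤ l1Norm (x - y)) :
    K.lazyProb G m x ≤ ENNReal.ofReal (S / ρ * √m) := by
  have hnn : ∀ y, 0 ≤ K.lazyWeights.ν y * (K.dens x m y * l1Norm (x - y)) := fun y =>
    mul_nonneg (K.lazyWeights.pos y).le (mul_nonneg (K.dens_nonneg x m y) (l1Norm_nonneg _))
  calc K.lazyProb G m x
      ≤ ∑' y, ENNReal.ofReal (ρ⁻¹ * (K.lazyWeights.ν y * (K.dens x m y * l1Norm (x - y)))) := by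
        refine ENNReal.tsum_le_tsum fun y => ?_
        by_cases hy : y ∈ G
        · rw [Set.indicator_of_mem hy, ← ENNReal.ofReal_coe_nnreal,
            ← ENNReal.ofReal_mul (NNReal.coe_nonneg _)]
          refine ENNReal.ofReal_le_ofReal ?_
          rw [inv_mul_eq_div, le_div_iff₀ hρ, mul_assoc]
          exact mul_le_mul_of_nonneg_left
            (mul_le_mul_of_nonneg_left (hG y hy) (K.dens_nonneg x m y)) (K.lazyWeights.pos y).le
        · rw [Set.indicator_of_notMem hy]; exact zero_le
    _ = ENNReal.ofReal (ρ⁻¹ * ∑' y, K.lazyWeights.ν y * (K.dens x m y * l1Norm (x - y))) := by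
        rw [← tsum_mul_left, ENNReal.ofReal_tsum_of_nonneg
          (fun y => mul_nonneg (inv_nonneg.2 hρ.le) (hnn y)) (hs.mul_left _)]
    _ ≤ _ := by
        refine ENNReal.ofReal_le_ofReal ?_
        calc ρ⁻¹ * _ ≤ ρ⁻¹ * (S * √m) := mul_le_mul_of_nonneg_left hS (inv_nonneg.2 hρ.le)
          _ = _ := by ring

lemma geomProb_le (h0 : 0 < lam) (h1 : lam < 1) (hS0 : 0 ≤ S) {x : IntLattice d}
    (hS : ∀ m : ℕ, Summable (fun y => K.lazyWeights.ν y * (K.dens x m y * l1Norm (x - y))) ∧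
        ∑' y, K.lazyWeights.ν y * (K.dens x m y * l1Norm (x - y)) ≤ S * √m)
    {G : Set (IntLattice d)} {ρ : ℝ} (hρ : 0 < ρ) (hG : ∀ y ∈ G, ρ ≤ l1Norm (x - y)) :
    K.geomProb lam G x ≤ ENNReal.ofReal (S / ρ / √(1 - lam)) := by
  set s := √(1 - lam) with hs
  have hs0 : 0 < s := Real.sqrt_pos.2 (by linarith)
  have hss : s ^ 2 = 1 - lam := Real.sq_sqrt (by linarith)
  -- Jensen's inequality for `√ξ`, by the arithmetic-geometric mean inequality
  have hsq : ∀ m : ℕ, √(m : ℝ) ≤ 1 / 2 * (1 / s + m * s) := fun m => by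
    have h2 : √(m : ℝ) ^ 2 = m := Real.sq_sqrt (Nat.cast_nonneg m)
    have h3 : 0 ≤ (1 - √(m : ℝ) * s) ^ 2 / s := by positivity
    have h4 : (1 - √(m : ℝ) * s) ^ 2 / s = 1 / s + √(m : ℝ) ^ 2 * s - 2 * √(m : ℝ) := by
      field_simp; ring
    rw [h4, h2] at h3
    linarith
  have hg := summable_geometric_of_lt_one h0.le h1
  have hnorm : ‖lam‖ < 1 := by rwa [Real.norm_of_nonneg h0.le]
  have hm := hasSum_coe_mul_geometric_of_norm_lt_one hnorm
  have hsum := ((((hasSum_geometric_of_lt_one h0.le h1).mul_left (1 / s)).add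
    (hm.mul_right s)).mul_left (S / ρ * (1 - lam) * (1 / 2)))
  have hval : S / ρ * (1 - lam) * (1 / 2) * (1 / s * (1 - lam)⁻¹ + lam / (1 - lam) ^ 2 * s) ≤
      S / ρ / s := by
    have h5 : S / ρ * (1 - lam) * (1 / 2) * (1 / s * (1 - lam)⁻¹ + lam / (1 - lam) ^ 2 * s) =
        S / ρ / s * (1 / 2 * (1 + lam)) := by
      rw [← hss]; field_simp
    rw [h5]
    exact mul_le_of_le_one_right (by positivity) (by linarith)
  calc K.geomProb lam G x
      ≤ ∑' m : ℕ, ENNReal.ofReal (S / ρ * (1 - lam) * (1 / 2) *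
          (1 / s * lam ^ m + m * lam ^ m * s)) := by
        refine ENNReal.tsum_le_tsum fun m => ?_
        refine (mul_le_mul_right (lazyProb_le (hS m).1 (hS m).2 hρ hG) _).trans ?_
        have h6 : 0 ≤ (1 - lam) * lam ^ m := mul_nonneg (by linarith) (pow_nonneg h0.le m)
        rw [← ENNReal.ofReal_mul h6]
        refine ENNReal.ofReal_le_ofReal ?_
        calc (1 - lam) * lam ^ m * (S / ρ * √m)
            ≤ (1 - lam) * lam ^ m * (S / ρ * (1 / 2 * (1 / s + m * s))) := by
              gcongr
              exact hsq m
          _ = _ := by ring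
    _ = ENNReal.ofReal (∑' m : ℕ, S / ρ * (1 - lam) * (1 / 2) *
          (1 / s * lam ^ m + m * lam ^ m * s)) := by
        rw [ENNReal.ofReal_tsum_of_nonneg (fun m => ?_) hsum.summable]
        have : 0 ≤ 1 - lam := by linarith
        positivity
    _ ≤ _ := by
        rw [hsum.tsum_eq]
        exact ENNReal.ofReal_le_ofReal hval

/-- A diffusive bound on the first moment of the lazy chain, uniform in the starting point, bounds
the exit probabilities of the chain itself. -/
lemma exit_le (hS0 : 0 ≤ S)
    (hS : ∀ x (m : ℕ), Summable (fun y => K.lazyWeights.ν y * (K.dens x m y * l1Norm (x - y))) ∧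
        ∑' y, K.lazyWeights.ν y * (K.dens x m y * l1Norm (x - y)) ≤ S * √m)
    {r : ℝ} (hr : 0 < r) {n : ℕ} (hn : 0 < n) (x : IntLattice d) :
    K.chainLaw x (staysIn (latticeBall x r) n)ᶜ ≤ ENNReal.ofReal (16 * S * √n / r) := by
  have hn' : (1 : ℝ) ≤ n := by exact_mod_cast hn
  set lam : ℝ := 1 - 1 / (4 * n) with hlam
  have hq : 1 / (4 * (n : ℝ)) ≤ 1 / 4 := by
    rw [div_le_div_iff₀ (by positivity) (by norm_num)]; linarith
  have hq0 : 0 < 1 / (4 * (n : ℝ)) := by positivity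
  have h0 : 0 < lam := by linarith
  have h1 : lam < 1 := by linarith
  set η := S / (r / 2) / √(1 - lam) with hη
  have hη4 : 4 * η = 16 * S * √n / r := by
    have h2 : √(1 - lam) = 1 / (2 * √n) := by
      have h3 : (1 - lam) = (1 / (2 * √(n : ℝ))) ^ 2 := by
        rw [hlam, div_pow, mul_pow, Real.sq_sqrt (by positivity)]; ring
      rw [h3, Real.sqrt_sq (by positivity)]
    rw [hη, h2]
    field_simp; ring
  rw [← hη4]
  have hη0 : 0 ≤ η := by positivity
  rcases lt_or_ge (1 / 2) η with hbig | hsmall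
  · refine prob_le_one.trans ?_
    rw [← ENNReal.ofReal_one]
    exact ENNReal.ofReal_le_ofReal (by linarith)
  set F : Set (IntLattice d) := {y | r / 2 ≤ latticeNorm (x - y)} with hF
  have hx : K.geomProb lam F x ≤ ENNReal.ofReal η :=
    geomProb_le h0 h1 hS0 (hS x) (by positivity) fun y hy => hy.trans (latticeNorm_le_l1Norm _)
  have hout : ∀ w ∉ latticeBall x r, (2⁻¹ : ℝ≥0∞) ≤ K.geomProb lam F w := by
    intro w hw
    have hc : K.geomProb lam Fᶜ w ≤ 2⁻¹ := by
      refine (geomProb_le h0 h1 hS0 (hS w) (half_pos hr) fun y hy => ?_).trans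
        ((ENNReal.ofReal_le_ofReal hsmall).trans ?_)
      · have h2 : r ≤ latticeNorm (x - w) := not_lt.1 hw
        have h3 : latticeNorm (x - y) < r / 2 := not_le.1 hy
        have h4 := latticeNorm_add_le (x - y) (y - w)
        rw [sub_add_sub_cancel, latticeNorm_sub_comm y w] at h4
        have := latticeNorm_le_l1Norm (w - y)
        linarith
      · rw [one_div, ENNReal.ofReal_inv_of_pos two_pos, ENNReal.ofReal_ofNat]
    have hadd := K.geomProb_add_compl h0.le h1 F w
    by_contra! hlt
    have := ENNReal.add_lt_add_of_lt_of_le (ne_top_of_le_ne_top (by simp) hc) hlt hc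
    rw [hadd, ENNReal.inv_two_add_inv_two] at this
    exact lt_irrefl _ this
  set μ : ℝ := lam / (2 - lam) with hμ
  have hμ0 : 0 ≤ μ := div_nonneg h0.le (by linarith)
  have hμ1 : μ ≤ 1 := by rw [hμ, div_le_one (by linarith)]; linarith
  have hmax := K.pow_mul_exit_le (μ := ENNReal.ofReal μ) (ENNReal.ofReal_le_one.2 hμ1)
    (K.geomProb_superharmonic h0 h1 F) hout x n
  -- Bernoulli's inequality
  have hpow : 1 / 2 ≤ μ ^ n := by
    have h2 : 1 - 1 / (2 * (n : ℝ)) ≤ μ := by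
      rw [hμ, le_div_iff₀ (by linarith), hlam]
      have h3 : 1 / (2 * (n : ℝ)) = 2 * (1 / (4 * n)) := by field_simp; norm_num
      rw [h3]
      nlinarith
    have h3 := one_add_mul_le_pow (a := -(1 / (2 * (n : ℝ)))) (by
      have : 1 / (2 * (n : ℝ)) ≤ 1 := by rw [div_le_one (by positivity)]; linarith
      linarith) n
    have h4 : (n : ℝ) * -(1 / (2 * n)) = -(1 / 2) := by field_simp
    rw [h4] at h3
    have h5 : (1 + -(1 / (2 * (n : ℝ)))) ^ n ≤ μ ^ n := by
      refine pow_le_pow_left₀ ?_ (by linarith) n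
      have : 1 / (2 * (n : ℝ)) ≤ 1 := by rw [div_le_one (by positivity)]; linarith
      linarith
    linarith
  have hfin : K.chainLaw x (staysIn (latticeBall x r) n)ᶜ ≠ ⊤ := measure_ne_top _ _
  set p := K.chainLaw x (staysIn (latticeBall x r) n)ᶜ with hp
  have h2 : (2⁻¹ : ℝ≥0∞) * (2⁻¹ * p) ≤ ENNReal.ofReal η := by
    refine le_trans (mul_le_mul_left ?_ _) (hmax.trans hx)
    rw [← ENNReal.ofReal_pow hμ0]
    have h3 : (2⁻¹ : ℝ≥0∞) = ENNReal.ofReal (1 / 2) := by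
      rw [one_div, ENNReal.ofReal_inv_of_pos two_pos, ENNReal.ofReal_ofNat]
    rw [h3]
    exact ENNReal.ofReal_le_ofReal hpow
  have h4 : p = 4 * ((2⁻¹ : ℝ≥0∞) * (2⁻¹ * p)) := by
    rw [← mul_assoc, ← mul_assoc]
    have h5 : (4 : ℝ≥0∞) * 2⁻¹ * 2⁻¹ = 1 := by
      have h6 : (4 : ℝ≥0∞) = 2 * 2 := by norm_num
      rw [h6, mul_assoc 2 2, ENNReal.mul_inv_cancel two_ne_zero (by simp), mul_one,
        ENNReal.mul_inv_cancel two_ne_zero (by simp)]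
    rw [h5, one_mul]
  rw [h4, ENNReal.ofReal_mul (by norm_num), ENNReal.ofReal_ofNat]
  exact mul_le_mul_right h2 _

end Conductances

/-! ### Exponential clocks and the continuous-time chain -/

section Exponential

/-- The Laplace transform of the exponential distribution. -/
lemma lintegral_exp_neg_expMeasure {r lam : ℝ} (hr : 0 < r) (hl : 0 ≤ lam) :
    ∫⁻ u, ENNReal.ofReal (Real.exp (-(lam * u))) ∂expMeasure r = ENNReal.ofReal (r / (r + lam)) := by
  have hm : Measurable (exponentialPDF r) := (measurable_exponentialPDFReal r).ennreal_ofReal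
  have he : expMeasure r = volume.withDensity (exponentialPDF r) := rfl
  rw [he, lintegral_withDensity_eq_lintegral_mul _ hm (by fun_prop)]
  have h : ∀ u, (exponentialPDF r * fun u => ENNReal.ofReal (Real.exp (-(lam * u)))) u =
      ENNReal.ofReal (r / (r + lam)) * exponentialPDF (r + lam) u := fun u => by
    rw [Pi.mul_apply, exponentialPDF_eq, exponentialPDF_eq]
    split_ifs with hu
    · rw [← ENNReal.ofReal_mul (by positivity), ← ENNReal.ofReal_mul (by positivity), mul_assoc,
        ← Real.exp_add, ← mul_assoc]
      congr 2
      · field_simp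
      · congr 1; ring
    · simp
  have hm' : Measurable (exponentialPDF (r + lam)) :=
    (measurable_exponentialPDFReal (r + lam)).ennreal_ofReal
  rw [lintegral_congr h, lintegral_const_mul _ hm',
    lintegral_exponentialPDF_eq_one (by positivity), mul_one]

lemma expMeasure_Iio_zero (r : ℝ) : expMeasure r (Set.Iio 0) = 0 := by
  have he : expMeasure r = volume.withDensity (exponentialPDF r) := rfl
  rw [he, withDensity_apply _ measurableSet_Iio]
  exact lintegral_exponentialPDF_of_nonpos le_rfl

end Exponential

namespace Conductances

variable {d : ℕ} (K : Conductances d)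

instance (p : ℕ × IntLattice d) : IsProbabilityMeasure (expMeasure (K.nu p.2)) :=
  isProbabilityMeasure_expMeasure (K.lazyWeights.pos p.2)

lemma clockLaw_nonneg : ∀ᵐ U ∂K.clockLaw, ∀ p, 0 ≤ U p := by
  rw [ae_all_iff]
  intro p
  have h := measurePreserving_eval_infinitePi (fun p : ℕ × IntLattice d => expMeasure (K.nu p.2)) p
  have h0 : ∀ᵐ u ∂expMeasure (K.nu p.2), 0 ≤ u := by
    rw [ae_iff]
    simp only [not_le]
    exact expMeasure_Iio_zero _
  exact h.quasiMeasurePreserving.ae h0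

/-- Chernoff's bound for the jump times along a fixed trajectory of the discrete chain. -/
lemma clockLaw_jumpTime_lt {c₂ : ℝ} (hν : ∀ y, (K.nu y : ℝ) ≤ c₂) {lam : ℝ} (hl : 0 < lam)
    (X : ℕ → IntLattice d) (n : ℕ) (s : ℝ) :
    K.clockLaw {U | jumpTime (X, U) n < s} ≤
      ENNReal.ofReal (Real.exp (lam * s) * (c₂ / (c₂ + lam)) ^ n) := by
  have hc₂ : 0 < c₂ := (K.lazyWeights.pos 0).trans_le (hν 0)
  set ι : ℕ → ℕ × IntLattice d := fun k => (k + 1, X k) with hι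
  have hinj : Function.Injective ι := fun a b h => by simpa [hι] using (Prod.ext_iff.1 h).1
  set G : ℕ → (ℕ × IntLattice d → ℝ) → ℝ≥0∞ :=
    fun k U => ENNReal.ofReal (Real.exp (-(lam * U (ι k)))) with hG
  have hGm : ∀ k, Measurable (G k) := fun k => by fun_prop
  have hind : iIndepFun G K.clockLaw := by
    have h1 : iIndepFun (fun (p : ℕ × IntLattice d) (U : ℕ × IntLattice d → ℝ) => U p)
        K.clockLaw :=
      iIndepFun_infinitePi (P := fun p : ℕ × IntLattice d => expMeasure (K.nu p.2))
        (X := fun _ u => u) fun _ => measurable_id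
    exact (h1.precomp hinj).comp (fun _ u => ENNReal.ofReal (Real.exp (-(lam * u))))
      fun _ => by fun_prop
  have hprod : ∫⁻ U, ∏ k ∈ Finset.range n, G k U ∂K.clockLaw ≤
      ENNReal.ofReal ((c₂ / (c₂ + lam)) ^ n) := by
    rw [lintegral_prod_eq_prod_lintegral_of_indepFun (Finset.range n) G hind hGm,
      ENNReal.ofReal_pow (by positivity)]
    refine (Finset.prod_le_prod' (g := fun _ => ENNReal.ofReal (c₂ / (c₂ + lam)))
      fun k _ => ?_).trans (by simp)
    have h := measurePreserving_eval_infinitePi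
      (fun p : ℕ × IntLattice d => expMeasure (K.nu p.2)) (ι k)
    have h2 : ∫⁻ U, G k U ∂K.clockLaw =
        ∫⁻ u, ENNReal.ofReal (Real.exp (-(lam * u))) ∂expMeasure (K.nu (X k)) :=
      h.lintegral_comp (f := fun u => ENNReal.ofReal (Real.exp (-(lam * u)))) (by fun_prop)
    have hk : (0 : ℝ) < K.nu (X k) := K.lazyWeights.pos (X k)
    rw [h2, lintegral_exp_neg_expMeasure hk hl.le]
    refine ENNReal.ofReal_le_ofReal ?_
    rw [div_le_div_iff₀ (by positivity) (by positivity)]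
    nlinarith [hν (X k)]
  calc K.clockLaw {U | jumpTime (X, U) n < s}
      ≤ K.clockLaw {U | 1 ≤ ENNReal.ofReal (Real.exp (lam * s)) *
          ∏ k ∈ Finset.range n, G k U} := by
        refine measure_mono fun U hU => ?_
        have hU : jumpTime (X, U) n < s := hU
        show (1 : ℝ≥0∞) ≤ _
        rw [← ENNReal.ofReal_prod_of_nonneg fun k _ => (Real.exp_pos _).le,
          ← Real.exp_sum, ← ENNReal.ofReal_mul (Real.exp_pos _).le, ← Real.exp_add,
          ← ENNReal.ofReal_one]
        refine ENNReal.ofReal_le_ofReal (Real.one_le_exp ?_)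
        rw [Finset.sum_neg_distrib, ← Finset.mul_sum]
        have : jumpTime (X, U) n = ∑ k ∈ Finset.range n, U (ι k) := rfl
        rw [← this]
        nlinarith
    _ ≤ ∫⁻ U, ENNReal.ofReal (Real.exp (lam * s)) * ∏ k ∈ Finset.range n, G k U ∂K.clockLaw := by
        have := mul_meas_ge_le_lintegral (μ := K.clockLaw)
          (f := fun U => ENNReal.ofReal (Real.exp (lam * s)) * ∏ k ∈ Finset.range n, G k U)
          ((Finset.measurable_fun_prod _ fun k _ => hGm k).const_mul _) 1
        rwa [one_mul] at this
    _ = ENNReal.ofReal (Real.exp (lam * s)) *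
          ∫⁻ U, ∏ k ∈ Finset.range n, G k U ∂K.clockLaw :=
        lintegral_const_mul _ (Finset.measurable_fun_prod _ fun k _ => hGm k)
    _ ≤ _ := by
        rw [ENNReal.ofReal_mul (Real.exp_pos _).le]
        exact mul_le_mul_right hprod _

lemma measurable_jumpTime (n : ℕ) :
    Measurable fun ω : (ℕ → IntLattice d) × (ℕ × IntLattice d → ℝ) => jumpTime ω n := by
  refine Finset.measurable_fun_sum _ fun k _ => ?_
  have h : Measurable fun q : (ℕ × IntLattice d → ℝ) × IntLattice d => q.1 (k + 1, q.2) :=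
    measurable_from_prod_countable_left fun i => measurable_pi_apply (k + 1, i)
  exact h.comp (measurable_snd.prodMk ((measurable_pi_apply k).comp measurable_fst))

lemma pathLaw_jumpTime_lt {c₂ : ℝ} (hν : ∀ y, (K.nu y : ℝ) ≤ c₂) {lam : ℝ} (hl : 0 < lam)
    (x : IntLattice d) (n : ℕ) (s : ℝ) :
    K.pathLaw x {ω | jumpTime ω n < s} ≤
      ENNReal.ofReal (Real.exp (lam * s) * (c₂ / (c₂ + lam)) ^ n) := by
  have hm : MeasurableSet {ω : (ℕ → IntLattice d) × (ℕ × IntLattice d → ℝ) | jumpTime ω n < s} :=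
    measurable_jumpTime n measurableSet_Iio
  rw [pathLaw, Measure.prod_apply hm]
  refine (lintegral_mono fun X => K.clockLaw_jumpTime_lt hν hl X n s).trans ?_
  rw [lintegral_const, measure_univ, mul_one]

/-- If the continuous-time chain leaves `S` before time `s`, then either the discrete chain leaves `S`
within its first `n` positions, or the `n`-th jump comes before time `s`. -/
lemma notMem_staysIn_or_jumpTime_lt {S : Set (IntLattice d)} {s : ℝ} {n : ℕ} (hn : 0 < n)
    {ω : (ℕ → IntLattice d) × (ℕ × IntLattice d → ℝ)} (hω : ∀ p, 0 ≤ ω.2 p)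
    (h : exitTime S (contChain ω) < ENNReal.ofReal s) :
    ω.1 ∈ (staysIn S n)ᶜ ∨ jumpTime ω n < s := by
  classical
  obtain ⟨t, ht⟩ := iInf_lt_iff.1 h
  obtain ⟨htS, hts⟩ := iInf_lt_iff.1 ht
  have hts' : (t : ℝ) < s := by
    rw [← ENNReal.ofReal_coe_nnreal] at hts
    exact (ENNReal.ofReal_lt_ofReal_iff_of_nonneg t.2).1 hts
  rw [contChain] at htS
  split_ifs at htS with hex
  · set k := Nat.find hex with hk
    have hspec := Nat.find_spec hex
    rw [← hk] at hspec
    rcases lt_or_ge k n with hkn | hkn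
    · exact Or.inl fun hstay => htS (hstay k hkn)
    · refine Or.inr (lt_of_le_of_lt ?_ (hspec.1.trans_lt hts'))
      exact Finset.sum_le_sum_of_subset_of_nonneg (Finset.range_mono hkn) fun i _ _ => hω _
  · exact Or.inl fun hstay => htS (hstay 0 hn)

lemma notMem_staysIn_of_discreteExitTime_lt {S : Set (IntLattice d)} {s : ℝ} {X : ℕ → IntLattice d}
    (h : discreteExitTime S X < ENNReal.ofReal s) : X ∈ (staysIn S ⌈s⌉₊)ᶜ := by
  obtain ⟨k, hk⟩ := iInf_lt_iff.1 h
  obtain ⟨hkS, hks⟩ := iInf_lt_iff.1 hk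
  rw [← ENNReal.ofReal_natCast] at hks
  have h1 := (ENNReal.ofReal_lt_ofReal_iff_of_nonneg (Nat.cast_nonneg k)).1 hks
  exact fun hstay => hkS (hstay k (Nat.lt_ceil.2 h1))

lemma chainLaw_staysIn_one_compl {S : Set (IntLattice d)} {x : IntLattice d} (hx : x ∈ S) :
    K.chainLaw x (staysIn S 1)ᶜ = 0 := by
  refine measure_eq_zero_iff_ae_notMem.2 ((K.chainLaw_zero x).mono fun X hX h => h fun k hk => ?_)
  obtain rfl : k = 0 := by omega
  rwa [hX]

end Conductances

theorem proposition3p3 (d : ℕ) (c₁ c₂ M₀ δ : ℝ) (φ : ℕ → ℝ)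
    (A B : ℝ) (hA : 0 < A) (hB₀ : 0 < B) (hB₁ : B < 1) :
    ∃ γ₁ ∈ Set.Ioo (0 : ℝ) 1, ∃ γ₂ ∈ Set.Ioo (0 : ℝ) 1,
      ∀ K : Conductances d, K.A1 c₁ c₂ → K.A2 M₀ δ → K.A3 φ →
        ∀ D : ℝ, 0 < D → ∀ x : IntLattice d,
          K.pathLaw x {ω | exitTime (latticeBall x (A * D)) (contChain ω)
              < ENNReal.ofReal (γ₁ * D ^ 2)} ≤ ENNReal.ofReal B ∧
          K.chainLaw x {X | discreteExitTime (latticeBall x (A * D)) X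
              < ENNReal.ofReal (γ₂ * D ^ 2)} ≤ ENNReal.ofReal B := by
  -- the constants are only needed if they are admissible for some conductances
  by_cases hpos : 0 < c₁ ∧ 0 < c₂ ∧ 0 < δ
  swap
  · exact ⟨1 / 2, by norm_num, 1 / 2, by norm_num, fun K h1 h2 _ =>
      absurd ⟨h1.1, h1.2.1, h2.2.1⟩ hpos⟩
  obtain ⟨hc₁, hc₂, hδ⟩ := hpos
  obtain ⟨S, hS0, hS⟩ := Conductances.exists_moment_dens_bound d hc₁ hc₂ M₀ hδ φ
  -- chosen so that `16 S √(2 γ₂) / A ≤ B / 2`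
  set γ₂ : ℝ := min (1 / 2) ((A * B / (32 * S)) ^ 2 / 2) with hγ₂
  have hγ₂0 : 0 < γ₂ := lt_min (by norm_num) (by positivity)
  have hγ₂1 : γ₂ < 1 := (min_le_left _ _).trans_lt (by norm_num)
  have hγ₂2 : √(2 * γ₂) ≤ A * B / (32 * S) := by
    refine Real.sqrt_le_iff.2 ⟨by positivity, ?_⟩
    linarith [min_le_right (1 / 2 : ℝ) ((A * B / (32 * S)) ^ 2 / 2)]
  -- at this rate each clock contributes a factor at most `B / 4` to Chernoff's bound
  set lam : ℝ := 4 * c₂ / B with hlam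
  have hlam0 : 0 < lam := by positivity
  have hlog2 : 0 < Real.log 2 := Real.log_pos (by norm_num)
  set γ₁ : ℝ := min (1 / 2) (γ₂ * Real.log 2 / lam) with hγ₁
  have hγ₁0 : 0 < γ₁ := lt_min (by norm_num) (by positivity)
  have hγ₁1 : γ₁ < 1 := (min_le_left _ _).trans_lt (by norm_num)
  have hγ₁2 : lam * γ₁ ≤ γ₂ * Real.log 2 := by
    rw [mul_comm, ← le_div_iff₀ hlam0]; exact min_le_right _ _
  refine ⟨γ₁, ⟨hγ₁0, hγ₁1⟩, γ₂, ⟨hγ₂0, hγ₂1⟩, fun K h1 h2 h3 D hD x => ?_⟩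
  have hr : 0 < A * D := by positivity
  set ball := latticeBall x (A * D) with hball
  have hx : x ∈ ball := by
    show latticeNorm (x - x) < A * D
    rwa [sub_self, latticeNorm_zero]
  set n := ⌈γ₂ * D ^ 2⌉₊ with hn
  have hγD : 0 < γ₂ * D ^ 2 := by positivity
  have hn0 : 0 < n := Nat.ceil_pos.2 hγD
  have hdisc : K.chainLaw x (Conductances.staysIn ball n)ᶜ ≤ ENNReal.ofReal (B / 2) := by
    rcases le_or_gt (γ₂ * D ^ 2) 1 with hle | hgt
    · have : n = 1 := by
        have : n ≤ 1 := Nat.ceil_le.2 (by exact_mod_cast hle)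
        omega
      rw [this, K.chainLaw_staysIn_one_compl hx]
      exact zero_le
    · refine (Conductances.exit_le hS0.le (hS K h1 h2 h3) hr hn0 x).trans
        (ENNReal.ofReal_le_ofReal ?_)
      have hn2 : (n : ℝ) ≤ 2 * γ₂ * D ^ 2 := by
        have := Nat.ceil_lt_add_one hγD.le
        linarith
      have hsq : √(n : ℝ) ≤ √(2 * γ₂) * D := by
        refine Real.sqrt_le_iff.2 ⟨by positivity, ?_⟩
        rwa [mul_pow, Real.sq_sqrt (by positivity)]
      rw [div_le_iff₀ hr]
      calc 16 * S * √(n : ℝ) ≤ 16 * S * (A * B / (32 * S) * D) := by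
            refine mul_le_mul_of_nonneg_left (hsq.trans ?_) (by positivity)
            exact mul_le_mul_of_nonneg_right hγ₂2 hD.le
        _ = B / 2 * (A * D) := by field_simp; ring
  refine ⟨?_, ?_⟩
  · have hsub : K.pathLaw x {ω | exitTime ball (contChain ω) < ENNReal.ofReal (γ₁ * D ^ 2)} ≤
        K.pathLaw x (((Conductances.staysIn ball n)ᶜ ×ˢ Set.univ) ∪
          {ω | jumpTime ω n < γ₁ * D ^ 2}) := by
      refine measure_mono_ae ?_
      have hclock : ∀ᵐ ω ∂K.pathLaw x, ∀ p, 0 ≤ ω.2 p :=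
        Measure.quasiMeasurePreserving_snd.ae K.clockLaw_nonneg
      filter_upwards [hclock] with ω hω h
      rcases Conductances.notMem_staysIn_or_jumpTime_lt hn0 hω h with h | h
      · exact Or.inl ⟨h, trivial⟩
      · exact Or.inr h
    refine hsub.trans ((measure_union_le _ _).trans ?_)
    have hB2 : ENNReal.ofReal B = ENNReal.ofReal (B / 2) + ENNReal.ofReal (B / 2) := by
      rw [← ENNReal.ofReal_add (by positivity) (by positivity), add_halves]
    rw [hB2]
    refine add_le_add ?_ ?_
    · rw [Conductances.pathLaw, Measure.prod_prod, measure_univ, mul_one]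
      exact hdisc
    · refine (K.pathLaw_jumpTime_lt (fun y => (h1.2.2 y).2) hlam0 x n _).trans
        (ENNReal.ofReal_le_ofReal ?_)
      have he : Real.exp (lam * (γ₁ * D ^ 2)) ≤ 2 ^ n := by
        have h4 : lam * (γ₁ * D ^ 2) ≤ n * Real.log 2 := by
          calc lam * (γ₁ * D ^ 2) = lam * γ₁ * D ^ 2 := by ring
            _ ≤ γ₂ * Real.log 2 * D ^ 2 := mul_le_mul_of_nonneg_right hγ₁2 (by positivity)
            _ = γ₂ * D ^ 2 * Real.log 2 := by ring
            _ ≤ n * Real.log 2 := mul_le_mul_of_nonneg_right (Nat.le_ceil _) hlog2.le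
        refine (Real.exp_le_exp.2 h4).trans (le_of_eq ?_)
        rw [Real.exp_nat_mul, Real.exp_log two_pos]
      have hq : c₂ / (c₂ + lam) ≤ B / 4 := by
        rw [hlam, div_le_div_iff₀ (by positivity) (by norm_num)]
        have : B * (c₂ + 4 * c₂ / B) = B * c₂ + 4 * c₂ := by field_simp
        rw [this]
        nlinarith
      calc Real.exp (lam * (γ₁ * D ^ 2)) * (c₂ / (c₂ + lam)) ^ n
          ≤ 2 ^ n * (B / 4) ^ n := by gcongr
        _ = (B / 2) ^ n := by rw [← mul_pow]; congr 1; ring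
        _ ≤ B / 2 := pow_le_of_le_one (by positivity) (by linarith) hn0.ne'
  · refine (measure_mono fun X hX => Conductances.notMem_staysIn_of_discreteExitTime_lt hX).trans
      (hdisc.trans (ENNReal.ofReal_le_ofReal (by linarith)))
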